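/- Let $n>1$, let $\Omega=(0,1)^n$ with Lebesgue measure $|\cdot|$, and let $p(\cdot):\Omega\to[1,\infty]$ be measurable. Suppose that for some constant $C>1$ and all sufficiently small $\lambda>0$, $$|\{x\in\Omega : p(x)\le 1+\lambda\}|\le C^{1/\lambda}\,\lambda^{(n-1)/\lambda}\,(\ln(1/\lambda))^{-(n-1)/\lambda}.$$ Let $L^{p(\cdot)}(\Omega)$ be the space of measurable $f:\Omega\to\mathbb{R}$ such that, for some $s>0$, $$\int_{\{p<\infty\}}\Big(\frac{|f(x)|}{s}\Big)^{p(x)}dx+s^{-1}\|f\|_{L^\infty(\{p=\infty\})}<\infty .$$ For $x\in\Omega$ let $\mathcal{B}_1(x)$ be the family of all open rectangles with sides parallel to the coordinate axes that contain $x$ and are contained in $\Omega$. Then every $f\in L^{p(\cdot)}(\Omega)$ is integrable on $\Omega$, and the basis $\mathcal{B}_1$ differentiates the integral of $f$ almost everywhere: for almost every $x\in\Omega$, $$\sup_{\{R_k\}}\limsup_{k\to\infty}\frac1{|R_k|}\int_{R_k}f(y)\,dy=\inf_{\{R_k\}}\liminf_{k\to\infty}\frac1{|R_k|}\int_{R_k}f(y)\,dy=f(x),$$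 where the supremum and the infimum are over all sequences $\{R_k\}\subset\mathcal{B}_1(x)$ with $\operatorname{diam}(R_k)\to0$. -/

import Mathlib

open MeasureTheory Filter Topology Set
open scoped ENNReal

noncomputable section

namespace StrongDiff

/-- The open unit cube `(0,1)^n`. -/
def unitCube (n : ℕ) : Set (Fin n → ℝ) :=
  Set.pi Set.univ (fun _ => Set.Ioo (0 : ℝ) 1)

/-- `p` is a (Lebesgue) measurable exponent function `Ω → [1, ∞]`; only its values on `Ω`
matter. -/
def IsExponent {n : ℕ} (Ω : Set (Fin n → ℝ)) (p : (Fin n → ℝ) → ℝ≥0∞) : Prop :=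
  AEMeasurable p (volume.restrict Ω) ∧ ∀ x ∈ Ω, 1 ≤ p x

/-- The modular `ρ_s(f) = ∫_{p < ∞} (|f(x)|/s)^{p(x)} dx + s⁻¹ ‖f‖_{L^∞({p = ∞})}`. -/
def modular {n : ℕ} (Ω : Set (Fin n → ℝ)) (p : (Fin n → ℝ) → ℝ≥0∞) (s : ℝ)
    (f : (Fin n → ℝ) → ℝ) : ℝ≥0∞ :=
  (∫⁻ x in {x ∈ Ω | p x ≠ ∞}, ENNReal.ofReal (|f x| / s) ^ (p x).toReal) +
    ENNReal.ofReal s⁻¹ * eLpNormEssSup f (volume.restrict {x ∈ Ω | p x = ∞})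

/-- Membership of `f` in the variable Lebesgue space `L^{p(·)}(Ω)`. -/
def MemVarLp {n : ℕ} (Ω : Set (Fin n → ℝ)) (p : (Fin n → ℝ) → ℝ≥0∞)
    (f : (Fin n → ℝ) → ℝ) : Prop :=
  AEMeasurable f (volume.restrict Ω) ∧ ∃ s : ℝ, 0 < s ∧ modular Ω p s f < ∞

/-- The basis of rectangles: at `x`, all bounded open rectangles with sides parallel to the
coordinate axes that contain `x` and are contained in `Ω`. -/
def rectBasis {n : ℕ} (Ω : Set (Fin n → ℝ)) (x : Fin n → ℝ) : Set (Set (Fin n → ℝ)) :=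
  {R | (∃ a b : Fin n → ℝ, R = Set.pi Set.univ (fun i => Set.Ioo (a i) (b i))) ∧
    x ∈ R ∧ R ⊆ Ω}

/-- The mean value `|R|⁻¹ ∫_R f`. -/
def mean {n : ℕ} (f : (Fin n → ℝ) → ℝ) (R : Set (Fin n → ℝ)) : ℝ :=
  (volume R).toReal⁻¹ * ∫ y in R, f y

/-- `R` is a sequence of members of the basis `B` at `x` whose diameters tend to `0`
(the diameter is taken in the maximum norm, which gives the same sequences as the
Euclidean norm). -/
def Contracts {n : ℕ} (B : (Fin n → ℝ) → Set (Set (Fin n → ℝ))) (x : Fin n → ℝ)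
    (R : ℕ → Set (Fin n → ℝ)) : Prop :=
  (∀ k, R k ∈ B x) ∧ Tendsto (fun k => Metric.diam (R k)) atTop (𝓝 0)

/-- The upper derivative of the integral of `f` at `x` with respect to the basis `B`. -/
def upperDerivative {n : ℕ} (B : (Fin n → ℝ) → Set (Set (Fin n → ℝ)))
    (f : (Fin n → ℝ) → ℝ) (x : Fin n → ℝ) : EReal :=
  ⨆ (R : ℕ → Set (Fin n → ℝ)) (_ : Contracts B x R),
    limsup (fun k => ((mean f (R k) : ℝ) : EReal)) atTop

/-- The lower derivative of the integral of `f` at `x` with respect to the basis `B`. -/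
def lowerDerivative {n : ℕ} (B : (Fin n → ℝ) → Set (Set (Fin n → ℝ)))
    (f : (Fin n → ℝ) → ℝ) (x : Fin n → ℝ) : EReal :=
  ⨅ (R : ℕ → Set (Fin n → ℝ)) (_ : Contracts B x R),
    liminf (fun k => ((mean f (R k) : ℝ) : EReal)) atTop

/-- The basis `B` in `Ω` differentiates the integral of `f`: at almost every point of `Ω` the
upper and the lower derivative coincide and their common value is `f x`. -/
def Differentiates {n : ℕ} (Ω : Set (Fin n → ℝ)) (B : (Fin n → ℝ) → Set (Set (Fin n → ℝ)))
    (f : (Fin n → ℝ) → ℝ) : Prop :=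
  ∀ᵐ x ∂(volume.restrict Ω),
    upperDerivative B f x = ((f x : ℝ) : EReal) ∧ lowerDerivative B f x = ((f x : ℝ) : EReal)

end StrongDiff

end

/-!
# Strong differentiation in variable exponent Lebesgue spaces

The theorem rests on two facts.

**Embedding.** If the exponent `p` is close to `1` only on the very small sets allowed by the
decay condition, then `L^{p(·)}` is contained in `L (log L) ^ (n - 1)`. Cut
`{1 < p ≤ 1 + 1 / k₀}` into the layers `1 + 1 / (k + 1) < p ≤ 1 + 1 / k` and choose on each
the threshold `T_k = (k log k / (2 C)) ^ ((n - 1) (k + 1))`. Above `T_k` the function `t (1 + log t) ^ (n - 1)` is at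
most a constant times `t ^ p`, with a constant independent of `k`
(`mul_one_add_log_pow_le_rpow`); below `T_k` its value is at most `layerBound`, and the decay
condition makes `layerBound` times the measure of the layer summable
(`layer_measure_mul_layerBound_le`).

**The Jessen–Marcinkiewicz–Zygmund theorem.** Averages over boxes with sides parallel to the
axes are dominated by the composition of the `n` one-dimensional maximal functions in the
directions of the axes (`lmarginal_Ioo_le_iteratedMax`). Each of them satisfies the weak type
inequality, and costs one power of the logarithm in integrals of Young functions. The latter is
cleanest for the dyadic Young functions `S_k(t) = ∑_{2 ^ j < t} 2 ^ j (j + 1) ^ k`, where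
summation by levels gives `∫ S_k (M g) ≤ 10 ∫ S_{k+1} (2 g)` without additive constants
(`lintegral_dyadicYoung_maximalFun_le`). If `f` is in `L (log L) ^ (n - 1)`, there is thus a
continuous `g` for which the composition of `n - 1` maximal functions of `|f - g|` has small
integral (`exists_continuous_lintegral_iteratedMax_le`). The weak type inequality for the
remaining direction then bounds the measure of the set where the averages of `f` over small
boxes stay away from `f` (`ae_abs_mean_sub_le`).
-/

noncomputable section

namespace StrongDiff

/-! ### The maximal function on the line -/

/-- The uncentred maximal function on `ℝ` of the measure `g dν`, taken over the open intervals with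
rational endpoints, so that it is a countable supremum. Masses are measured by `ν`, lengths by
Lebesgue measure. -/
def maximalFun (ν : Measure ℝ) (g : ℝ → ℝ≥0∞) (t : ℝ) : ℝ≥0∞ :=
  ⨆ q : ℚ × ℚ, (Ioo (q.1 : ℝ) q.2).indicator
    (fun _ => (∫⁻ y in Ioo (q.1 : ℝ) q.2, g y ∂ν) / volume (Ioo (q.1 : ℝ) q.2)) t

lemma measurable_maximalFun (ν : Measure ℝ) (g : ℝ → ℝ≥0∞) : Measurable (maximalFun ν g) :=
  Measurable.iSup fun _ => measurable_const.indicator measurableSet_Ioo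

lemma maximalFun_const_mul (ν : Measure ℝ) {g : ℝ → ℝ≥0∞} (hg : Measurable g) (c : ℝ≥0∞) (t : ℝ) :
    maximalFun ν (fun y => c * g y) t = c * maximalFun ν g t := by
  simp only [maximalFun, ENNReal.mul_iSup]
  congr with q
  by_cases h : t ∈ Ioo (q.1 : ℝ) q.2
  · simp [h, lintegral_const_mul _ hg, mul_div_assoc]
  · simp [h]

lemma lt_maximalFun_iff {ν : Measure ℝ} {g : ℝ → ℝ≥0∞} {t : ℝ} {l : ℝ≥0∞} :
    l < maximalFun ν g t ↔ ∃ q : ℚ × ℚ, t ∈ Ioo (q.1 : ℝ) q.2 ∧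
      l < (∫⁻ y in Ioo (q.1 : ℝ) q.2, g y ∂ν) / volume (Ioo (q.1 : ℝ) q.2) := by
  simp only [maximalFun, lt_iSup_iff]
  refine exists_congr fun q => ?_
  by_cases h : t ∈ Ioo (q.1 : ℝ) q.2 <;> simp [h]

/-- The maximal function controls the averages over all intervals, up to a factor `2` lost in
enlarging an interval to one with rational endpoints. -/
lemma setLIntegral_Ioo_le_maximalFun (ν : Measure ℝ) (g : ℝ → ℝ≥0∞) {a b t : ℝ}
    (ht : t ∈ Ioo a b) :
    ∫⁻ y in Ioo a b, g y ∂ν ≤ 2 * volume (Ioo a b) * maximalFun ν g t := by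
  have hab : a < b := ht.1.trans ht.2
  obtain ⟨q, hq1, hq2⟩ := exists_rat_btwn (show a - (b - a) / 2 < a by linarith)
  obtain ⟨r, hr1, hr2⟩ := exists_rat_btwn (show b < b + (b - a) / 2 by linarith)
  have htm : t ∈ Ioo (q : ℝ) r := ⟨hq2.trans ht.1, ht.2.trans hr1⟩
  have hle : (∫⁻ y in Ioo (q : ℝ) r, g y ∂ν) / volume (Ioo (q : ℝ) r) ≤ maximalFun ν g t := by
    refine le_trans ?_ (le_iSup _ (q, r))
    simp [htm]
  have hv : volume (Ioo (q : ℝ) r) ≤ 2 * volume (Ioo a b) := by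
    rw [Real.volume_Ioo, Real.volume_Ioo, ← ENNReal.ofReal_ofNat,
      ← ENNReal.ofReal_mul (by norm_num)]
    exact ENNReal.ofReal_le_ofReal (by linarith)
  have h0 : volume (Ioo (q : ℝ) r) ≠ 0 := by
    have := htm.1.trans htm.2
    simpa [Real.volume_Ioo] using this
  calc ∫⁻ y in Ioo a b, g y ∂ν ≤ ∫⁻ y in Ioo (q : ℝ) r, g y ∂ν :=
        lintegral_mono_set (Ioo_subset_Ioo hq2.le hr1.le)
    _ = volume (Ioo (q : ℝ) r) * ((∫⁻ y in Ioo (q : ℝ) r, g y ∂ν) / volume (Ioo (q : ℝ) r)) :=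
        (ENNReal.mul_div_cancel h0 (by simp [Real.volume_Ioo])).symm
    _ ≤ _ := mul_le_mul' hv hle

/-- The weak type `(1,1)` inequality, by Vitali's covering lemma. -/
lemma mul_volume_lt_maximalFun_le (ν : Measure ℝ) (g : ℝ → ℝ≥0∞) (l : ℝ≥0∞) :
    l * volume {t | l < maximalFun ν g t} ≤ 5 * ∫⁻ y, g y ∂ν := by
  rcases eq_or_ne l 0 with rfl | hl
  · simp
  rcases eq_or_ne l ∞ with rfl | hl'
  · simp
  rcases eq_or_ne (∫⁻ y, g y ∂ν) ∞ with hI | hI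
  · simp [hI]
  set A : Set (ℚ × ℚ) := {q | (q.1 : ℝ) < q.2 ∧
    l < (∫⁻ y in Ioo (q.1 : ℝ) q.2, g y ∂ν) / volume (Ioo (q.1 : ℝ) q.2)} with hA
  set c : ℚ × ℚ → ℝ := fun q => ((q.1 : ℝ) + q.2) / 2
  set r : ℚ × ℚ → ℝ := fun q => ((q.2 : ℝ) - q.1) / 2
  have hball : ∀ q, Ioo (q.1 : ℝ) q.2 ⊆ Metric.closedBall (c q) (r q) := by
    intro q
    rw [Real.closedBall_eq_Icc]
    intro t ht
    simp only [c, r]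
    constructor <;> linarith [ht.1, ht.2]
  have hmass : ∀ q ∈ A, l * ENNReal.ofReal ((q.2 : ℝ) - q.1) ≤
      ∫⁻ y in Ioo (q.1 : ℝ) q.2, g y ∂ν := by
    intro q hq
    have := hq.2.le
    rw [Real.volume_Ioo] at this
    exact ENNReal.mul_le_of_le_div this
  have hrad : ∀ q ∈ A, r q ≤ ((∫⁻ y, g y ∂ν) / l).toReal := by
    intro q hq
    have h1 : ENNReal.ofReal ((q.2 : ℝ) - q.1) ≤ (∫⁻ y, g y ∂ν) / l := by
      rw [ENNReal.le_div_iff_mul_le (.inl hl) (.inl hl'), mul_comm]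
      exact (hmass q hq).trans (setLIntegral_le_lintegral _ _)
    have h2 := (ENNReal.ofReal_le_iff_le_toReal (ENNReal.div_ne_top hI hl)).1 h1
    have h3 := hq.1
    simp only [r]
    linarith
  obtain ⟨u, huA, hdisj, hcov⟩ := Vitali.exists_disjoint_subfamily_covering_enlargement_closedBall
    A c r _ hrad 5 (by norm_num)
  have hsub : {t | l < maximalFun ν g t} ⊆ ⋃ q ∈ u, Metric.closedBall (c q) (5 * r q) := by
    intro t ht
    obtain ⟨q, htq, hq⟩ := lt_maximalFun_iff.1 ht
    obtain ⟨b, hb, hqb⟩ := hcov q ⟨htq.1.trans htq.2, hq⟩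
    exact mem_biUnion hb (hqb (hball q htq))
  have hu : u.Countable := u.to_countable
  calc l * volume {t | l < maximalFun ν g t}
      ≤ l * ∑' q : u, volume (Metric.closedBall (c q) (5 * r q)) := by
        gcongr
        exact (measure_mono hsub).trans (measure_biUnion_le _ hu _)
    _ = ∑' q : u, 5 * (l * ENNReal.ofReal (((q : ℚ × ℚ).2 : ℝ) - (q : ℚ × ℚ).1)) := by
        rw [← ENNReal.tsum_mul_left]
        congr with q
        rw [Real.volume_closedBall, show 2 * (5 * r q) =
          5 * (((q : ℚ × ℚ).2 : ℝ) - (q : ℚ × ℚ).1) by simp only [r]; ring,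
          ENNReal.ofReal_mul (by norm_num), ENNReal.ofReal_ofNat]
        ring
    _ ≤ ∑' q : u, 5 * ∫⁻ y in Ioo ((q : ℚ × ℚ).1 : ℝ) (q : ℚ × ℚ).2, g y ∂ν := by
        gcongr with q
        exact hmass q (huA q.2)
    _ = 5 * ∫⁻ y in ⋃ q ∈ u, Ioo (q.1 : ℝ) q.2, g y ∂ν := by
        rw [ENNReal.tsum_mul_left, lintegral_biUnion hu (fun _ _ => measurableSet_Ioo)
          (fun q hq q' hq' h => (hdisj hq hq' h).mono (hball q) (hball q'))]
    _ ≤ 5 * ∫⁻ y, g y ∂ν := by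
        gcongr
        exact Measure.restrict_le_self

/-! ### Dyadic Young functions -/

/-- A dyadic substitute for the Young function `t (log⁺ t) ^ k`, namely
`∑ 2 ^ j * (j + 1) ^ k` over all `j ≥ 0` with `2 ^ j < t`. -/
def dyadicYoung (k : ℕ) (t : ℝ≥0∞) : ℝ≥0∞ :=
  ∑' j : ℕ, (Ioi ((2 : ℝ≥0∞) ^ j)).indicator (fun _ => 2 ^ j * ((j : ℝ≥0∞) + 1) ^ k) t

lemma measurable_dyadicYoung (k : ℕ) : Measurable (dyadicYoung k) :=
  Measurable.tsum fun _ => measurable_const.indicator measurableSet_Ioi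

lemma monotone_dyadicYoung (k : ℕ) : Monotone (dyadicYoung k) := by
  intro s t hst
  refine ENNReal.tsum_le_tsum fun j => ?_
  by_cases h : (2 : ℝ≥0∞) ^ j < s
  · simp [h, h.trans_le hst]
  · simp [h]

lemma dyadicYoung_of_le_one (k : ℕ) {t : ℝ≥0∞} (ht : t ≤ 1) : dyadicYoung k t = 0 := by
  simp only [dyadicYoung, ENNReal.tsum_eq_zero]
  intro j
  have : ¬ (2 : ℝ≥0∞) ^ j < t := not_lt.2 (ht.trans (one_le_pow₀ (by norm_num)))
  simp [this]

lemma dyadicYoung_add_le (k : ℕ) (s t : ℝ≥0∞) :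
    dyadicYoung k (s + t) ≤ dyadicYoung k (2 * s) + dyadicYoung k (2 * t) := by
  rcases le_total s t with h | h
  · refine (monotone_dyadicYoung k ?_).trans le_add_self
    rw [two_mul]; gcongr
  · refine (monotone_dyadicYoung k ?_).trans le_self_add
    rw [two_mul]; gcongr

lemma two_pow_mul_le_dyadicYoung (k : ℕ) {j : ℕ} {t : ℝ≥0∞} (h : (2 : ℝ≥0∞) ^ j < t) :
    2 ^ j * ((j : ℝ≥0∞) + 1) ^ k ≤ dyadicYoung k t := by
  refine le_trans ?_ (ENNReal.le_tsum j)
  simp [h]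

/-- A finite number above `1` lies in a dyadic interval `(2 ^ J, 2 ^ (J + 1)]`. -/
lemma exists_two_pow_lt_le {t : ℝ≥0∞} (h1 : 1 < t) (ht : t ≠ ∞) :
    ∃ J : ℕ, (2 : ℝ≥0∞) ^ J < t ∧ t ≤ 2 ^ (J + 1) := by
  have hex : ∃ n : ℕ, t ≤ 2 ^ n := by
    obtain ⟨n, hn⟩ := pow_unbounded_of_one_lt t.toReal (one_lt_two)
    refine ⟨n, ?_⟩
    rw [← ENNReal.ofReal_toReal ht]
    refine (ENNReal.ofReal_le_ofReal hn.le).trans_eq ?_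
    rw [ENNReal.ofReal_pow (by norm_num), ENNReal.ofReal_ofNat]
  classical
  have h0 : Nat.find hex ≠ 0 := by
    intro h
    have := Nat.find_spec hex
    rw [h, pow_zero] at this
    exact absurd h1 (not_lt.2 this)
  obtain ⟨J, hJ⟩ := Nat.exists_eq_succ_of_ne_zero h0
  refine ⟨J, not_le.1 (Nat.find_min hex (by omega)), ?_⟩
  have := Nat.find_spec hex
  rwa [hJ] at this

lemma dyadicYoung_top (k : ℕ) : dyadicYoung k ∞ = ∞ := by
  refine ENNReal.eq_top_of_forall_nnreal_le fun r => ?_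
  obtain ⟨n, hn⟩ := pow_unbounded_of_one_lt r (one_lt_two)
  calc (r : ℝ≥0∞) ≤ 2 ^ n := by exact_mod_cast hn.le
    _ ≤ 2 ^ n * ((n : ℝ≥0∞) + 1) ^ k := le_mul_of_one_le_right' (one_le_pow₀ le_add_self)
    _ ≤ _ := two_pow_mul_le_dyadicYoung k (by simp)

lemma le_one_add_dyadicYoung (t : ℝ≥0∞) : t ≤ 1 + dyadicYoung 0 t := by
  rcases eq_or_ne t ∞ with rfl | ht
  · simp [dyadicYoung_top]
  rcases le_or_gt t 1 with h | h
  · exact h.trans le_self_add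
  obtain ⟨J, hJ1, hJ2⟩ := exists_two_pow_lt_le h ht
  have hgeom : ∀ m : ℕ, 1 + ∑ j ∈ Finset.range m, (2 : ℝ≥0∞) ^ j = 2 ^ m := by
    intro m
    induction m with
    | zero => simp
    | succ m ih => rw [Finset.sum_range_succ, ← add_assoc, ih, pow_succ]; ring
  calc t ≤ 1 + ∑ j ∈ Finset.range (J + 1), (2 : ℝ≥0∞) ^ j := by rw [hgeom]; exact hJ2
    _ ≤ 1 + dyadicYoung 0 t := by
      gcongr
      refine le_trans (Finset.sum_le_sum fun j hj => ?_)
        (ENNReal.sum_le_tsum (Finset.range (J + 1)))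
      have : (2 : ℝ≥0∞) ^ j < t := lt_of_le_of_lt
        (pow_le_pow_right₀ (by norm_num) (by simpa [Nat.lt_succ_iff] using hj)) hJ1
      simp [this]

/-- Summation over the dyadic levels below `2 t` raises the exponent of the logarithm by one. -/
lemma mul_tsum_indicator_le_dyadicYoung (k : ℕ) (t : ℝ≥0∞) :
    t * ∑' j : ℕ, (Ioi ((2 : ℝ≥0∞) ^ j)).indicator (fun _ => ((j : ℝ≥0∞) + 1) ^ k) (2 * t) ≤
      dyadicYoung (k + 1) (2 * t) := by
  rcases eq_or_ne t ∞ with rfl | ht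
  · simp [dyadicYoung_top]
  rcases le_or_gt (2 * t) 1 with h | h
  · have : ∀ j : ℕ, ¬ (2 : ℝ≥0∞) ^ j < 2 * t := fun j =>
      not_lt.2 (h.trans (one_le_pow₀ (by norm_num)))
    simp [this]
  obtain ⟨J, hJ1, hJ2⟩ := exists_two_pow_lt_le h (ENNReal.mul_ne_top (by norm_num) ht)
  have hsum : ∑' j : ℕ, (Ioi ((2 : ℝ≥0∞) ^ j)).indicator (fun _ => ((j : ℝ≥0∞) + 1) ^ k) (2 * t)
      ≤ ((J : ℝ≥0∞) + 1) ^ (k + 1) := by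
    rw [tsum_eq_sum (s := Finset.range (J + 1))]
    · calc _ ≤ ∑ j ∈ Finset.range (J + 1), ((J : ℝ≥0∞) + 1) ^ k := by
            refine Finset.sum_le_sum fun j hj => (indicator_le_self _ _ _).trans ?_
            have : j ≤ J := by simpa [Nat.lt_succ_iff] using hj
            gcongr
        _ = _ := by simp [pow_succ, mul_comm]
    · intro j hj
      have hj' : J + 1 ≤ j := by simpa using hj
      have : ¬ (2 : ℝ≥0∞) ^ j < 2 * t :=
        not_lt.2 (hJ2.trans (pow_le_pow_right₀ (by norm_num) hj'))
      simp [this]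
  have ht2 : t ≤ 2 ^ J := by
    rw [pow_succ, mul_comm] at hJ2
    exact (ENNReal.mul_le_mul_iff_left (c := 2) (by norm_num) (by norm_num)).1
      (by simpa [mul_comm] using hJ2)
  exact (mul_le_mul' ht2 hsum).trans (two_pow_mul_le_dyadicYoung _ hJ1)

/-- The maximal function costs one power of the logarithm: this is the weak type inequality for the
part of `g` above half of each dyadic level, summed over the levels. -/
lemma lintegral_dyadicYoung_maximalFun_le {ν : Measure ℝ} (hν : ν ≤ volume) {g : ℝ → ℝ≥0∞}
    (hg : Measurable g) (k : ℕ) :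
    ∫⁻ t, dyadicYoung k (maximalFun ν g t) ∂ν ≤ 10 * ∫⁻ t, dyadicYoung (k + 1) (2 * g t) ∂ν := by
  have hm := measurable_maximalFun ν g
  have hlevel : ∀ j : ℕ, (2 : ℝ≥0∞) ^ j * ν {t | 2 ^ j < maximalFun ν g t} ≤
      10 * ∫⁻ t in {t | 2 ^ j < 2 * g t}, g t ∂ν := by
    intro j
    have hS : MeasurableSet {t | (2 : ℝ≥0∞) ^ j < 2 * g t} :=
      measurableSet_lt measurable_const (hg.const_mul 2)
    -- The part of `g` below `2 ^ j / 2` contributes at most `2 ^ j / 2` to the averages.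
    have hsub : {t | (2 : ℝ≥0∞) ^ j < maximalFun ν g t} ⊆
        {t | (2 : ℝ≥0∞) ^ j / 2 < maximalFun ν ({t | 2 ^ j < 2 * g t}.indicator g) t} := by
      intro t ht
      obtain ⟨q, htq, hq⟩ := lt_maximalFun_iff.1 ht
      refine lt_maximalFun_iff.2 ⟨q, htq, ?_⟩
      set I := Ioo (q.1 : ℝ) q.2
      have hI0 : volume I ≠ 0 := by
        have := htq.1.trans htq.2
        simpa [I, Real.volume_Ioo] using this
      have hIt : volume I ≠ ∞ := by simp [I, Real.volume_Ioo]
      have h1 : ∫⁻ y in I, g y ∂ν ≤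
          (∫⁻ y in I, {t | (2 : ℝ≥0∞) ^ j < 2 * g t}.indicator g y ∂ν) + 2 ^ j / 2 * volume I := by
        calc ∫⁻ y in I, g y ∂ν
            ≤ ∫⁻ y in I, ({t | (2 : ℝ≥0∞) ^ j < 2 * g t}.indicator g y + 2 ^ j / 2) ∂ν := by
              refine lintegral_mono fun y => ?_
              by_cases hy : (2 : ℝ≥0∞) ^ j < 2 * g y
              · simp [hy]
              · have : g y ≤ 2 ^ j / 2 := by
                  rw [ENNReal.le_div_iff_mul_le (by simp) (by simp), mul_comm]
                  exact not_lt.1 hy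
                simpa [hy] using this
          _ ≤ _ := by
              rw [lintegral_add_right _ measurable_const]
              simp only [lintegral_const, Measure.restrict_apply_univ]
              gcongr
      have h2 : (2 : ℝ≥0∞) ^ j <
          (∫⁻ y in I, {t | (2 : ℝ≥0∞) ^ j < 2 * g t}.indicator g y ∂ν) / volume I + 2 ^ j / 2 := by
        refine lt_of_lt_of_le hq ?_
        rw [ENNReal.div_le_iff hI0 hIt, add_mul, ENNReal.div_mul_cancel hI0 hIt]
        exact h1
      by_contra hcon
      refine absurd h2 (not_lt.2 ?_)
      calc _ ≤ (2 : ℝ≥0∞) ^ j / 2 + 2 ^ j / 2 := add_le_add_left (not_lt.1 hcon) _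
        _ = 2 ^ j := ENNReal.add_halves _
    calc (2 : ℝ≥0∞) ^ j * ν {t | 2 ^ j < maximalFun ν g t}
        ≤ 2 ^ j * volume {t | (2 : ℝ≥0∞) ^ j / 2 <
            maximalFun ν ({t | 2 ^ j < 2 * g t}.indicator g) t} := by
          exact mul_le_mul_right ((hν _).trans (measure_mono hsub)) _
      _ = 2 * ((2 : ℝ≥0∞) ^ j / 2 * volume {t | (2 : ℝ≥0∞) ^ j / 2 <
            maximalFun ν ({t | 2 ^ j < 2 * g t}.indicator g) t}) := by
          rw [← mul_assoc, ENNReal.mul_div_cancel (by norm_num) (by norm_num)]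
      _ ≤ 2 * (5 * ∫⁻ t, {t | (2 : ℝ≥0∞) ^ j < 2 * g t}.indicator g t ∂ν) := by
          exact mul_le_mul_right (mul_volume_lt_maximalFun_le _ _ _) _
      _ = _ := by
          rw [lintegral_indicator hS, ← mul_assoc]
          norm_num
  calc ∫⁻ t, dyadicYoung k (maximalFun ν g t) ∂ν
      = ∑' j : ℕ, ((j : ℝ≥0∞) + 1) ^ k * (2 ^ j * ν {t | 2 ^ j < maximalFun ν g t}) := by
        simp only [dyadicYoung]
        rw [lintegral_tsum]
        swap
        · exact fun j => ((measurable_const.indicator measurableSet_Ioi).comp hm).aemeasurable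
        congr with j
        have : ∀ t, (Ioi ((2 : ℝ≥0∞) ^ j)).indicator (fun _ => 2 ^ j * ((j : ℝ≥0∞) + 1) ^ k)
            (maximalFun ν g t) = {t | 2 ^ j < maximalFun ν g t}.indicator
              (fun _ => 2 ^ j * ((j : ℝ≥0∞) + 1) ^ k) t := fun t => rfl
        simp only [this]
        rw [lintegral_indicator (measurableSet_lt measurable_const hm)]
        simp only [lintegral_const, Measure.restrict_apply_univ]
        ring
    _ ≤ ∑' j : ℕ, ((j : ℝ≥0∞) + 1) ^ k * (10 * ∫⁻ t in {t | 2 ^ j < 2 * g t}, g t ∂ν) := by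
        exact ENNReal.tsum_le_tsum fun j => mul_le_mul_right (hlevel j) _
    _ = 10 * ∫⁻ t, g t * ∑' j : ℕ, (Ioi ((2 : ℝ≥0∞) ^ j)).indicator
          (fun _ => ((j : ℝ≥0∞) + 1) ^ k) (2 * g t) ∂ν := by
        simp_rw [← ENNReal.tsum_mul_left]
        rw [lintegral_tsum]
        swap
        · exact fun j => (hg.mul ((measurable_const.indicator
            measurableSet_Ioi).comp (hg.const_mul 2))).aemeasurable
        rw [← ENNReal.tsum_mul_left]
        congr with j
        have : ∀ t, g t * (Ioi ((2 : ℝ≥0∞) ^ j)).indicator (fun _ => ((j : ℝ≥0∞) + 1) ^ k)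
            (2 * g t) = {t | 2 ^ j < 2 * g t}.indicator
              (fun t => ((j : ℝ≥0∞) + 1) ^ k * g t) t := by
          intro t
          by_cases h : (2 : ℝ≥0∞) ^ j < 2 * g t
          · simpa [h] using mul_comm _ _
          · simp [h]
        simp only [this]
        rw [lintegral_indicator (measurableSet_lt measurable_const (hg.const_mul 2)),
          lintegral_const_mul _ hg]
        ring
    _ ≤ _ := by
        gcongr with t
        exact mul_tsum_indicator_le_dyadicYoung k (g t)

/-! ### Iterated directional maximal functions -/

section Directional

variable {ι : Type*} [DecidableEq ι]

/-- The maximal function in the direction of the `i`-th coordinate. -/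
def directionalMax (ν : Measure ℝ) (i : ι) (h : (ι → ℝ) → ℝ≥0∞) (x : ι → ℝ) : ℝ≥0∞ :=
  maximalFun ν (fun t => h (Function.update x i t)) (x i)

/-- The composition of the directional maximal functions along a list of coordinates, the last
coordinate of the list acting first. -/
def iteratedMax (ν : Measure ℝ) (l : List ι) (h : (ι → ℝ) → ℝ≥0∞) : (ι → ℝ) → ℝ≥0∞ :=
  l.foldr (directionalMax ν) h

variable {ν : Measure ℝ} {h : (ι → ℝ) → ℝ≥0∞}

lemma iteratedMax_cons (i : ι) (l : List ι) :
    iteratedMax ν (i :: l) h = directionalMax ν i (iteratedMax ν l h) := rfl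

lemma directionalMax_update (i : ι) (x : ι → ℝ) (t : ℝ) :
    directionalMax ν i h (Function.update x i t) =
      maximalFun ν (fun s => h (Function.update x i s)) t := by
  simp [directionalMax]

lemma measurable_directionalMax [SigmaFinite ν] (i : ι) (hh : Measurable h) :
    Measurable (directionalMax ν i h) := by
  refine Measurable.iSup fun q => ?_
  have h1 : Measurable fun x : ι → ℝ =>
      ∫⁻ y in Ioo (q.1 : ℝ) q.2, h (Function.update x i y) ∂ν := by
    have := hh.lmarginal (fun _ : ι => ν.restrict (Ioo (q.1 : ℝ) q.2)) (s := {i})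
    simpa only [lmarginal_singleton] using this
  have h2 : MeasurableSet {x : ι → ℝ | x i ∈ Ioo (q.1 : ℝ) q.2} :=
    measurable_pi_apply i measurableSet_Ioo
  exact (h1.div_const _).indicator h2

lemma measurable_iteratedMax [SigmaFinite ν] (l : List ι) (hh : Measurable h) :
    Measurable (iteratedMax ν l h) := by
  induction l with
  | nil => exact hh
  | cons i l ih => exact measurable_directionalMax i ih

lemma iteratedMax_const_mul [SigmaFinite ν] (l : List ι) (hh : Measurable h) (c : ℝ≥0∞) :
    iteratedMax ν l (fun x => c * h x) = fun x => c * iteratedMax ν l h x := by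
  induction l with
  | nil => rfl
  | cons i l ih =>
    funext x
    rw [iteratedMax_cons, ih]
    exact maximalFun_const_mul ν
      ((measurable_iteratedMax l hh).comp (measurable_update x)) c (x i)

/-- The average of `h` over a box containing `x` is at most `2 ^ d` times the value at `x` of the
maximal function iterated over the `d` sides of the box. -/
lemma lmarginal_Ioo_le_iteratedMax [SigmaFinite ν] (hh : Measurable h) (a b : ι → ℝ) (l : List ι)
    (hl : l.Nodup) (x : ι → ℝ) (hx : ∀ i ∈ l, x i ∈ Ioo (a i) (b i)) :
    (∫⋯∫⁻_l.toFinset, h ∂fun i => ν.restrict (Ioo (a i) (b i))) x ≤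
      2 ^ l.length * (∏ i ∈ l.toFinset, volume (Ioo (a i) (b i))) * iteratedMax ν l h x := by
  induction l generalizing x with
  | nil => simp [iteratedMax]
  | cons i l ih =>
    obtain ⟨hil, hl⟩ := List.nodup_cons.1 hl
    have hil' : i ∉ l.toFinset := by simpa using hil
    rw [List.toFinset_cons, lmarginal_insert _ hh hil', Finset.prod_insert hil']
    have hx' : ∀ t, ∀ j ∈ l, Function.update x i t j ∈ Ioo (a j) (b j) := by
      intro t j hj
      rw [Function.update_of_ne (by rintro rfl; exact hil hj)]
      exact hx j (List.mem_cons_of_mem _ hj)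
    set P := ∏ j ∈ l.toFinset, volume (Ioo (a j) (b j))
    calc _ ≤ ∫⁻ t in Ioo (a i) (b i),
          2 ^ l.length * P * iteratedMax ν l h (Function.update x i t) ∂ν :=
          lintegral_mono fun t => ih hl _ (hx' t)
      _ = 2 ^ l.length * P *
          ∫⁻ t in Ioo (a i) (b i), iteratedMax ν l h (Function.update x i t) ∂ν :=
          lintegral_const_mul _ ((measurable_iteratedMax l hh).comp (measurable_update x))
      _ ≤ 2 ^ l.length * P * (2 * volume (Ioo (a i) (b i)) * iteratedMax ν (i :: l) h x) :=
          mul_le_mul_right (setLIntegral_Ioo_le_maximalFun ν _ (hx i List.mem_cons_self)) _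
      _ = _ := by rw [List.length_cons, pow_succ]; ring

variable [Fintype ι] [SigmaFinite ν]

/-- The weak type inequality for a directional maximal function, from the one on each line. -/
lemma mul_measure_lt_directionalMax_le (hν : ν ≤ volume) (hh : Measurable h) (i : ι) (c : ℝ≥0∞) :
    c * Measure.pi (fun _ : ι => ν) {x | c < directionalMax ν i h x} ≤
      5 * ∫⁻ x, h x ∂Measure.pi (fun _ : ι => ν) := by
  have hm := measurable_directionalMax (ν := ν) i hh
  have hS : MeasurableSet {x | c < directionalMax ν i h x} := measurableSet_lt measurable_const hm
  have key := lintegral_le_of_lmarginal_le (μ := fun _ : ι => ν) {i}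
    (f := {x | c < directionalMax ν i h x}.indicator fun _ => c) (g := fun x => 5 * h x)
    (measurable_const.indicator hS) (hh.const_mul 5) (by
      intro x
      simp only [lmarginal_singleton]
      rw [lintegral_const_mul (f := fun t => h (Function.update x i t)) _
        (hh.comp (measurable_update x))]
      refine le_trans ?_ (mul_volume_lt_maximalFun_le ν _ c)
      have : ∀ t, {x | c < directionalMax ν i h x}.indicator (fun _ => c) (Function.update x i t) =
          {t | c < maximalFun ν (fun s => h (Function.update x i s)) t}.indicator
            (fun _ => c) t := by
        intro t
        simp only [indicator, mem_ofPred_eq, directionalMax_update]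
      simp only [this]
      rw [lintegral_indicator (measurableSet_lt measurable_const (measurable_maximalFun _ _))]
      simp only [lintegral_const, Measure.restrict_apply_univ]
      exact mul_le_mul_right (hν _) _)
  rw [lintegral_indicator hS, lintegral_const_mul _ hh] at key
  simpa using key

lemma lintegral_dyadicYoung_directionalMax_le (hν : ν ≤ volume) (hh : Measurable h) (i : ι)
    (k : ℕ) :
    ∫⁻ x, dyadicYoung k (directionalMax ν i h x) ∂Measure.pi (fun _ : ι => ν) ≤
      10 * ∫⁻ x, dyadicYoung (k + 1) (2 * h x) ∂Measure.pi (fun _ : ι => ν) := by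
  have hm := measurable_directionalMax (ν := ν) i hh
  have h2 : Measurable fun x => dyadicYoung (k + 1) (2 * h x) :=
    (measurable_dyadicYoung _).comp (hh.const_mul 2)
  rw [← lintegral_const_mul _ h2]
  refine lintegral_le_of_lmarginal_le (μ := fun _ : ι => ν) {i}
    ((measurable_dyadicYoung k).comp hm) (h2.const_mul 10) fun x => ?_
  simp only [lmarginal_singleton]
  rw [lintegral_const_mul (f := fun t => dyadicYoung (k + 1) (2 * h (Function.update x i t))) _
    (h2.comp (measurable_update x))]
  simp only [directionalMax_update]
  exact lintegral_dyadicYoung_maximalFun_le hν (hh.comp (measurable_update x)) k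

lemma lintegral_dyadicYoung_iteratedMax_le (hν : ν ≤ volume) (hh : Measurable h) (l : List ι)
    (k : ℕ) :
    ∫⁻ x, dyadicYoung k (iteratedMax ν l h x) ∂Measure.pi (fun _ : ι => ν) ≤
      10 ^ l.length * ∫⁻ x, dyadicYoung (k + l.length) (2 ^ l.length * h x)
        ∂Measure.pi (fun _ : ι => ν) := by
  induction l generalizing k h with
  | nil => simp [iteratedMax]
  | cons i l ih =>
    refine (lintegral_dyadicYoung_directionalMax_le hν (measurable_iteratedMax l hh) i k).trans ?_
    have h3 := ih (hh.const_mul 2) (k + 1)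
    rw [iteratedMax_const_mul l hh] at h3
    refine (mul_le_mul_right h3 10).trans_eq ?_
    rw [List.length_cons, pow_succ' 10, mul_assoc]
    simp only [pow_succ, mul_assoc, add_assoc, add_comm 1]

end Directional

/-! ### Approximation by continuous functions -/

/-- On bounded sets the dyadic Young functions are at most linear. -/
lemma exists_dyadicYoung_le_mul (k : ℕ) {T : ℝ≥0∞} (hT : T ≠ ∞) :
    ∃ K : ℝ≥0∞, K ≠ ∞ ∧ ∀ t ≤ T, dyadicYoung k t ≤ K * t := by
  obtain ⟨J, hJ⟩ : ∃ J : ℕ, T ≤ 2 ^ J := by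
    rcases le_or_gt T 1 with h | h
    · exact ⟨0, by simpa using h⟩
    · obtain ⟨J, -, hJ⟩ := exists_two_pow_lt_le h hT
      exact ⟨J + 1, hJ⟩
  refine ⟨∑ j ∈ Finset.range J, ((j : ℝ≥0∞) + 1) ^ k, ?_, fun t ht => ?_⟩
  · refine (ENNReal.sum_lt_top.2 fun j _ => ?_).ne
    exact ENNReal.pow_lt_top (by simp)
  · rw [dyadicYoung, tsum_eq_sum (s := Finset.range J), Finset.sum_mul]
    · refine Finset.sum_le_sum fun j _ => ?_
      by_cases h : (2 : ℝ≥0∞) ^ j < t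
      · simp only [indicator, mem_Ioi, h, if_true]
        rw [mul_comm]
        gcongr
      · simp [h]
    · intro j hj
      have hj' : J ≤ j := by simpa using hj
      have : ¬ (2 : ℝ≥0∞) ^ j < t :=
        not_lt.2 ((ht.trans hJ).trans (pow_le_pow_right₀ (by norm_num) hj'))
      simp [this]

section Approximation

variable {ι : Type*} [DecidableEq ι] [Fintype ι] {ν : Measure ℝ} [IsProbabilityMeasure ν]

/-- Scaling by `ε` turns the additive constant of `t ≤ 1 + dyadicYoung 0 t` into `ε`. -/
lemma lintegral_iteratedMax_le (hν : ν ≤ volume) {h : (ι → ℝ) → ℝ≥0∞} (hh : Measurable h)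
    (l : List ι) {ε : ℝ≥0∞} (h0 : ε ≠ 0) (ht : ε ≠ ∞) :
    ∫⁻ x, iteratedMax ν l h x ∂Measure.pi (fun _ : ι => ν) ≤
      ε + ε * (10 ^ l.length * ∫⁻ x, dyadicYoung l.length (2 ^ l.length * ε⁻¹ * h x)
        ∂Measure.pi (fun _ : ι => ν)) := by
  have hm := measurable_iteratedMax (ν := ν) l (hh.const_mul ε⁻¹)
  have hscale : ∀ x, iteratedMax ν l h x = ε * iteratedMax ν l (fun x => ε⁻¹ * h x) x := by
    intro x
    rw [iteratedMax_const_mul l hh, ← mul_assoc, ENNReal.mul_inv_cancel h0 ht, one_mul]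
  have key := lintegral_dyadicYoung_iteratedMax_le hν (hh.const_mul ε⁻¹) l 0
  rw [zero_add] at key
  simp only [← mul_assoc] at key ⊢
  calc ∫⁻ x, iteratedMax ν l h x ∂Measure.pi (fun _ : ι => ν)
      = ε * ∫⁻ x, iteratedMax ν l (fun x => ε⁻¹ * h x) x ∂Measure.pi (fun _ : ι => ν) := by
        simp only [hscale]
        exact lintegral_const_mul _ hm
    _ ≤ ε * ∫⁻ x, (1 + dyadicYoung 0 (iteratedMax ν l (fun x => ε⁻¹ * h x) x))
          ∂Measure.pi (fun _ : ι => ν) :=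
        mul_le_mul_right (lintegral_mono fun x => le_one_add_dyadicYoung _) _
    _ = ε + ε * ∫⁻ x, dyadicYoung 0 (iteratedMax ν l (fun x => ε⁻¹ * h x) x)
          ∂Measure.pi (fun _ : ι => ν) := by
        rw [lintegral_add_left measurable_const, mul_add]
        simp
    _ ≤ _ := by
        rw [mul_assoc ε]
        exact add_le_add_right (mul_le_mul_right key _) _

/-- A function all of whose multiples have finite Orlicz modular is approximated by continuous
functions so well that even the iterated maximal function of the error has small integral: the
large values are cut off by dominated convergence, and on bounded functions the Young function is
at most linear, so that density of continuous functions in `L¹` suffices. -/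
lemma exists_continuous_lintegral_iteratedMax_le (hν : ν ≤ volume) (l : List ι)
    {f : (ι → ℝ) → ℝ} (hf : Measurable f) (hf1 : Integrable f (Measure.pi fun _ : ι => ν))
    (hY : ∀ c : ℝ≥0∞, c ≠ ∞ →
      ∫⁻ x, dyadicYoung l.length (c * ‖f x‖ₑ) ∂Measure.pi (fun _ : ι => ν) ≠ ∞)
    {η : ℝ≥0∞} (hη : η ≠ 0) (hη' : η ≠ ∞) :
    ∃ g : (ι → ℝ) → ℝ, Continuous g ∧
      ∫⁻ x, ‖f x - g x‖ₑ ∂Measure.pi (fun _ : ι => ν) ≤ η ∧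
      ∫⁻ x, iteratedMax ν l (fun x => ‖f x - g x‖ₑ) x ∂Measure.pi (fun _ : ι => ν) ≤ η := by
  set π := Measure.pi fun _ : ι => ν
  set m := l.length
  set ε := η / 2
  have hε0 : ε ≠ 0 := by simp [ε, hη]
  have hεt : ε ≠ ∞ := by simp [ε, ENNReal.div_eq_top, hη']
  set c : ℝ≥0∞ := 2 * (2 ^ m * ε⁻¹)
  have hc : c ≠ ∞ := by
    refine ENNReal.mul_ne_top (by simp) (ENNReal.mul_ne_top (by simp) (by simpa using hε0))
  set κ : ℝ≥0∞ := (10 ^ m)⁻¹ / 2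
  have hκ0 : 0 < κ := ENNReal.div_pos (by simp) (by simp)
  set f₁ : ℕ → (ι → ℝ) → ℝ := fun N => {x | |f x| ≤ N}.indicator f
  have hset : ∀ N : ℕ, MeasurableSet {x | |f x| ≤ N} := fun N =>
    measurableSet_le hf.abs measurable_const
  have hf₁ : ∀ N, Measurable (f₁ N) := fun N => hf.indicator (hset N)
  have hbound : ∀ N x, ‖f x - f₁ N x‖ₑ ≤ ‖f x‖ₑ := by
    intro N x
    by_cases hx : |f x| ≤ N <;> simp [f₁, hx]
  have hev : ∀ x, ∀ᶠ N in atTop, ‖f x - f₁ N x‖ₑ = 0 := by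
    intro x
    obtain ⟨N₀, hN₀⟩ := exists_nat_ge |f x|
    filter_upwards [eventually_ge_atTop N₀] with N hN
    have : |f x| ≤ N := hN₀.trans (by exact_mod_cast hN)
    simp [f₁, this]
  have hlim1 : Tendsto (fun N => ∫⁻ x, ‖f x - f₁ N x‖ₑ ∂π) atTop (𝓝 0) := by
    have := tendsto_lintegral_of_dominated_convergence (μ := π) (f := fun _ => 0)
      (fun x => ‖f x‖ₑ) (fun N => (hf.sub (hf₁ N)).enorm) (fun N => ae_of_all _ (hbound N))
      hf1.2.ne (ae_of_all _ fun x => tendsto_const_nhds.congr' ((hev x).mono fun N hN => hN.symm))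
    simpa using this
  have hlim2 : Tendsto (fun N => ∫⁻ x, dyadicYoung m (c * ‖f x - f₁ N x‖ₑ) ∂π) atTop (𝓝 0) := by
    have := tendsto_lintegral_of_dominated_convergence (μ := π) (f := fun _ => 0)
      (F := fun N x => dyadicYoung m (c * ‖f x - f₁ N x‖ₑ))
      (fun x => dyadicYoung m (c * ‖f x‖ₑ))
      (fun N => (measurable_dyadicYoung m).comp ((hf.sub (hf₁ N)).enorm.const_mul c))
      (fun N => ae_of_all _ fun x => monotone_dyadicYoung m (mul_le_mul_right (hbound N x) c))
      (hY c hc) (ae_of_all _ fun x => tendsto_const_nhds.congr' ((hev x).mono fun N hN => by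
        simp only [hN, mul_zero, dyadicYoung_of_le_one m zero_le_one]))
    simpa using this
  obtain ⟨N, hN1, hN2⟩ := ((hlim1.eventually_le_const (pos_iff_ne_zero.2 hε0)).and
    (hlim2.eventually_le_const hκ0)).exists
  obtain ⟨K, hK, hKle⟩ := exists_dyadicYoung_le_mul m (T := c * (2 * N))
    (ENNReal.mul_ne_top hc (ENNReal.mul_ne_top (by simp) (by simp)))
  set θ : ℝ≥0∞ := min ε (κ / (K * c))
  have hθ : θ ≠ 0 := by
    simp only [θ, ne_eq, min_eq_bot, ← bot_eq_zero, not_or] at *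
    refine ⟨hε0, (ENNReal.div_pos hκ0.ne' (ENNReal.mul_ne_top hK hc)).ne'⟩
  obtain ⟨g₀, hg₀, -⟩ := (memLp_one_iff_integrable.2
    (hf1.indicator (hset N))).exists_boundedContinuous_eLpNorm_sub_le (by simp) hθ
  -- Truncating at the bound `N` of `f₁ N` does not increase the distance.
  set g : (ι → ℝ) → ℝ := fun x => max (-(N : ℝ)) (min (N : ℝ) (g₀ x))
  have hgc : Continuous g := continuous_const.max (continuous_const.min g₀.continuous)
  have hfN : ∀ x, |f₁ N x| ≤ N := by
    intro x
    by_cases hx : |f x| ≤ N <;> simp [f₁, hx]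
  have hgN : ∀ x, |g x| ≤ N := fun x =>
    abs_le.2 ⟨le_max_left _ _, max_le (by linarith [N.cast_nonneg (α := ℝ)]) (min_le_left _ _)⟩
  have hgf : ∀ x, ‖f₁ N x - g x‖ₑ ≤ ‖f₁ N x - g₀ x‖ₑ := by
    intro x
    have h1 := abs_le.1 (hfN x)
    have h2 : f₁ N x = max (-(N : ℝ)) (min (N : ℝ) (f₁ N x)) := by
      rw [min_eq_right h1.2, max_eq_right h1.1]
    refine enorm_le_iff_norm_le.2 ?_
    rw [Real.norm_eq_abs, Real.norm_eq_abs]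
    conv_lhs => rw [h2]
    refine (abs_max_sub_max_le_max _ _ _ _).trans ?_
    rw [sub_self, abs_zero, max_eq_right (abs_nonneg _)]
    simpa using abs_min_sub_min_le_max (N : ℝ) (f₁ N x) N (g₀ x)
  have hg2N : ∀ x, ‖f₁ N x - g x‖ₑ ≤ 2 * N := by
    intro x
    have : ‖f₁ N x - g x‖ ≤ ((2 * N : ℕ) : ℝ) := by
      push_cast
      have := abs_sub (f₁ N x) (g x)
      rw [Real.norm_eq_abs]
      linarith [hfN x, hgN x]
    have h3 := ENNReal.ofReal_le_ofReal this
    rw [ofReal_norm, ENNReal.ofReal_natCast] at h3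
    exact_mod_cast h3
  have hgint : ∫⁻ x, ‖f₁ N x - g x‖ₑ ∂π ≤ θ := by
    refine (lintegral_mono hgf).trans ?_
    rw [eLpNorm_one_eq_lintegral_enorm] at hg₀
    exact hg₀
  have htri : ∀ x, ‖f x - g x‖ₑ ≤ ‖f x - f₁ N x‖ₑ + ‖f₁ N x - g x‖ₑ := by
    intro x
    refine le_trans (le_of_eq ?_) (enorm_add_le _ _)
    congr 1
    ring
  have hm1 : Measurable fun x => ‖f x - f₁ N x‖ₑ := (hf.sub (hf₁ N)).enorm
  have hm2 : Measurable fun x => ‖f₁ N x - g x‖ₑ := ((hf₁ N).sub hgc.measurable).enorm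
  refine ⟨g, hgc, ?_, ?_⟩
  · calc ∫⁻ x, ‖f x - g x‖ₑ ∂π ≤ ∫⁻ x, (‖f x - f₁ N x‖ₑ + ‖f₁ N x - g x‖ₑ) ∂π :=
          lintegral_mono htri
      _ ≤ ε + ε := by
          rw [lintegral_add_left hm1]
          exact add_le_add hN1 (hgint.trans (min_le_left _ _))
      _ = η := ENNReal.add_halves η
  · have hsmall : ∫⁻ x, dyadicYoung m (2 ^ m * ε⁻¹ * ‖f x - g x‖ₑ) ∂π ≤ (10 ^ m)⁻¹ := by
      calc ∫⁻ x, dyadicYoung m (2 ^ m * ε⁻¹ * ‖f x - g x‖ₑ) ∂π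
          ≤ ∫⁻ x, (dyadicYoung m (c * ‖f x - f₁ N x‖ₑ) + K * c * ‖f₁ N x - g x‖ₑ) ∂π := by
            refine lintegral_mono fun x => ?_
            calc _ ≤ dyadicYoung m
                  (2 ^ m * ε⁻¹ * ‖f x - f₁ N x‖ₑ + 2 ^ m * ε⁻¹ * ‖f₁ N x - g x‖ₑ) := by
                  refine monotone_dyadicYoung m ?_
                  rw [← mul_add]
                  exact mul_le_mul_right (htri x) _
              _ ≤ dyadicYoung m (c * ‖f x - f₁ N x‖ₑ) + dyadicYoung m (c * ‖f₁ N x - g x‖ₑ) := by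
                  simpa only [c, mul_assoc] using dyadicYoung_add_le m
                    (2 ^ m * ε⁻¹ * ‖f x - f₁ N x‖ₑ) (2 ^ m * ε⁻¹ * ‖f₁ N x - g x‖ₑ)
              _ ≤ _ := by
                  rw [mul_assoc K]
                  exact add_le_add_right (hKle _ (mul_le_mul_right (hg2N x) c)) _
        _ ≤ κ + K * c * (κ / (K * c)) := by
            rw [lintegral_add_right _ (hm2.const_mul _), lintegral_const_mul _ hm2]
            exact add_le_add hN2 (mul_le_mul_right (hgint.trans (min_le_right _ _)) _)
        _ ≤ κ + κ := add_le_add_right ENNReal.mul_div_le _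
        _ = (10 ^ m)⁻¹ := ENNReal.add_halves _
    refine (lintegral_iteratedMax_le hν (hf.sub hgc.measurable).enorm l hε0 hεt).trans ?_
    calc _ ≤ ε + ε * (10 ^ m * (10 ^ m)⁻¹) :=
          add_le_add_right (mul_le_mul_right (mul_le_mul_right hsmall _) _) _
      _ = η := by
          rw [ENNReal.mul_inv_cancel (by simp) (by simp), mul_one]
          exact ENNReal.add_halves η

end Approximation

/-! ### Differentiation by boxes -/

lemma volume_restrict_unitCube (n : ℕ) :
    (volume : Measure (Fin n → ℝ)).restrict (unitCube n) =
      Measure.pi fun _ => volume.restrict (Ioo (0 : ℝ) 1) := by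
  rw [unitCube, volume_pi, Measure.restrict_pi_pi]

instance : IsProbabilityMeasure (volume.restrict (Ioo (0 : ℝ) 1)) :=
  ⟨by simp⟩

lemma setLIntegral_box_le_iteratedMax {n : ℕ} {h : (Fin n → ℝ) → ℝ≥0∞} (hh : Measurable h)
    {x : Fin n → ℝ} {R : Set (Fin n → ℝ)} (hR : R ∈ rectBasis (unitCube n) x) :
    ∫⁻ y in R, h y ≤ 2 ^ n * volume R *
      iteratedMax (volume.restrict (Ioo (0 : ℝ) 1)) (List.finRange n) h x := by
  obtain ⟨⟨a, b, rfl⟩, hx, hsub⟩ := hR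
  have hl : (List.finRange n).toFinset = Finset.univ := by ext; simp
  have key := lmarginal_Ioo_le_iteratedMax (ν := volume.restrict (Ioo (0 : ℝ) 1)) hh a b
    (List.finRange n) (List.nodup_finRange n) x fun i _ => hx i (mem_univ i)
  rw [hl, ← lintegral_eq_lmarginal_univ, List.length_finRange] at key
  rw [← Measure.restrict_restrict_of_subset hsub, volume_restrict_unitCube,
    Measure.restrict_pi_pi, volume_pi_pi]
  exact key

/-- **Jessen–Marcinkiewicz–Zygmund theorem** on the unit cube, for functions whose multiples have
finite modular for the dyadic version of the Young function `t (log⁺ t) ^ (n - 1)`. -/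
theorem ae_abs_mean_sub_le {n : ℕ} (hn : 0 < n) {f : (Fin n → ℝ) → ℝ} (hf : Measurable f)
    (hf1 : IntegrableOn f (unitCube n))
    (hY : ∀ c : ℝ≥0∞, c ≠ ∞ → ∫⁻ x in unitCube n, dyadicYoung (n - 1) (c * ‖f x‖ₑ) ≠ ∞) :
    ∀ᵐ x ∂volume.restrict (unitCube n), ∀ δ > 0, ∃ r > 0, ∀ R ∈ rectBasis (unitCube n) x,
      Metric.diam R < r → |mean f R - f x| ≤ δ := by
  suffices H : ∀ δ : ℝ, 0 < δ → ∀ᵐ x ∂volume.restrict (unitCube n), ∃ r > 0,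
      ∀ R ∈ rectBasis (unitCube n) x, Metric.diam R < r → |mean f R - f x| ≤ δ by
    have H' := ae_all_iff.2 fun k : ℕ => H (1 / ((k : ℝ) + 1)) (by positivity)
    filter_upwards [H'] with x hx δ hδ
    obtain ⟨k, hk⟩ := exists_nat_one_div_lt hδ
    obtain ⟨r, hr, hr'⟩ := hx k
    exact ⟨r, hr, fun R hR hd => (hr' R hR hd).trans hk.le⟩
  intro δ hδ
  obtain ⟨m, rfl⟩ : ∃ m, n = m + 1 := ⟨n - 1, by omega⟩
  set ν := (volume : Measure ℝ).restrict (Ioo (0 : ℝ) 1)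
  have hν : ν ≤ volume := Measure.restrict_le_self
  set d : ℝ≥0∞ := ENNReal.ofReal (δ / 3)
  have hd0 : d ≠ 0 := by simp [d, hδ]
  set c : ℝ≥0∞ := d / 2 ^ (m + 1)
  have hc0 : c ≠ 0 := by
    refine (ENNReal.div_pos hd0 (by simp)).ne'
  have hcd : c ≤ d := ENNReal.div_le_of_le_mul (le_mul_of_one_le_right' (one_le_pow₀ (by norm_num)))
  obtain ⟨i₀, l, hl⟩ : ∃ (i₀ : Fin (m + 1)) (l : List (Fin (m + 1))),
      List.finRange (m + 1) = i₀ :: l := ⟨_, _, List.finRange_succ⟩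
  have hlen : l.length = m := by
    have := congrArg List.length hl
    simpa using this.symm
  rw [IntegrableOn, volume_restrict_unitCube] at hf1
  rw [volume_restrict_unitCube, Nat.add_sub_cancel] at hY
  replace hY : ∀ c : ℝ≥0∞, c ≠ ∞ →
      ∫⁻ x, dyadicYoung l.length (c * ‖f x‖ₑ) ∂Measure.pi (fun _ : Fin (m + 1) => ν) ≠ ∞ := by
    simpa only [hlen] using hY
  rw [ae_iff]
  set B := {x | ¬∃ r > 0, ∀ R ∈ rectBasis (unitCube (m + 1)) x, Metric.diam R < r →
    |mean f R - f x| ≤ δ}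
  suffices hB : ∀ η : ℝ≥0∞, η ≠ 0 → η ≠ ∞ → c * volume.restrict (unitCube (m + 1)) B ≤ 6 * η by
    have h0 : c * volume.restrict (unitCube (m + 1)) B ≤ 0 := by
      refine ENNReal.le_of_forall_pos_le_add fun e he _ => ?_
      refine (hB (e / 6) (by simpa using he.ne') (by
        simp [ENNReal.div_eq_top])).trans ?_
      rw [ENNReal.mul_div_cancel (by simp) (by simp), zero_add]
    exact (mul_eq_zero.1 (le_zero_iff.1 h0)).resolve_left hc0
  intro η hη hη'
  obtain ⟨g, hg, hgint, hgmax⟩ := exists_continuous_lintegral_iteratedMax_le hν l hf hf1 hY hη hη'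
  set h : (Fin (m + 1) → ℝ) → ℝ≥0∞ := fun x => ‖f x - g x‖ₑ
  have hh : Measurable h := (hf.sub hg.measurable).enorm
  have hsub : B ⊆ {x | c < directionalMax ν i₀ (iteratedMax ν l h) x} ∪ {x | d ≤ h x} := by
    intro x hx
    by_contra hcon
    simp only [mem_union, mem_ofPred_eq, not_or, not_lt, not_le] at hcon
    obtain ⟨hM, hhx⟩ := hcon
    refine hx ?_
    obtain ⟨r, hr, hgr⟩ := Metric.continuous_iff.1 hg x (δ / 3) (by positivity)
    refine ⟨r, hr, fun R hR hdiam => ?_⟩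
    have hbd : Bornology.IsBounded R := by
      refine Bornology.IsBounded.subset ?_ hR.2.2
      exact Bornology.IsBounded.pi fun _ => Metric.isBounded_Ioo _ _
    have hRm : MeasurableSet R := by
      obtain ⟨⟨a, b, rfl⟩, -⟩ := hR
      exact MeasurableSet.univ_pi fun _ => measurableSet_Ioo
    have hRt : volume R ≠ ∞ := hbd.measure_lt_top.ne
    have hR0 : volume R ≠ 0 := by
      obtain ⟨⟨a, b, rfl⟩, hxR, -⟩ := hR
      exact ((isOpen_set_pi finite_univ fun _ _ => isOpen_Ioo).measure_pos volume ⟨x, hxR⟩).ne'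
    have hpt : ∀ y ∈ R, ‖f y - f x‖ₑ ≤ h y + ENNReal.ofReal (2 * (δ / 3)) := by
      intro y hy
      have h1 : dist (g y) (g x) < δ / 3 :=
        hgr y ((Metric.dist_le_diam_of_mem hbd hy hR.2.1).trans_lt hdiam)
      have h2 : ‖f x - g x‖ < δ / 3 := by
        have := hhx
        simp only [h, d, ← ofReal_norm] at this
        exact (ENNReal.ofReal_lt_ofReal_iff (by positivity)).1 this
      have h3 : ‖f y - f x‖ ≤ ‖f y - g y‖ + 2 * (δ / 3) := by
        rw [dist_eq_norm] at h1
        calc ‖f y - f x‖ = ‖(f y - g y) + ((g y - g x) - (f x - g x))‖ := by congr 1; ring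
          _ ≤ ‖f y - g y‖ + (‖g y - g x‖ + ‖f x - g x‖) :=
            (norm_add_le _ _).trans (add_le_add_right (norm_sub_le _ _) _)
          _ ≤ _ := by linarith
      simp only [h, ← ofReal_norm]
      rw [← ENNReal.ofReal_add (norm_nonneg _) (by positivity)]
      exact ENNReal.ofReal_le_ofReal h3
    have hint : ∫⁻ y in R, ‖f y - f x‖ₑ ≤ ENNReal.ofReal δ * volume R := by
      calc ∫⁻ y in R, ‖f y - f x‖ₑ ≤ ∫⁻ y in R, (h y + ENNReal.ofReal (2 * (δ / 3))) :=
            setLIntegral_mono' hRm hpt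
        _ = (∫⁻ y in R, h y) + ENNReal.ofReal (2 * (δ / 3)) * volume R := by
            rw [lintegral_add_left hh]; simp
        _ ≤ d * volume R + ENNReal.ofReal (2 * (δ / 3)) * volume R := by
            refine add_le_add_left ((setLIntegral_box_le_iteratedMax hh hR).trans ?_) _
            rw [hl, iteratedMax_cons]
            calc _ ≤ 2 ^ (m + 1) * volume R * c := mul_le_mul_right hM _
              _ = 2 ^ (m + 1) * c * volume R := by ring
              _ = d * volume R := by rw [ENNReal.mul_div_cancel (by simp) (by simp)]
        _ = ENNReal.ofReal δ * volume R := by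
            rw [← add_mul, ← ENNReal.ofReal_add (by positivity) (by positivity)]
            congr 2
            ring
    have hfR : IntegrableOn f R := by
      have : IntegrableOn f (unitCube (m + 1)) := by
        rw [IntegrableOn, volume_restrict_unitCube]; exact hf1
      exact this.mono_set hR.2.2
    have hvpos : 0 < (volume R).toReal := ENNReal.toReal_pos hR0 hRt
    have heq : ∫ y in R, (f y - f x) = (volume R).toReal * (mean f R - f x) := by
      rw [integral_sub hfR (integrableOn_const hRt), mean, mul_sub, mul_inv_cancel_left₀ hvpos.ne']
      simp [Measure.real]
    have hle := (enorm_integral_le_lintegral_enorm _).trans hint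
    rw [heq, ← ofReal_norm, ← ENNReal.ofReal_toReal hRt, ← ENNReal.ofReal_mul hδ.le,
      ENNReal.ofReal_le_ofReal_iff (by positivity), norm_mul, ENNReal.toReal_ofReal hvpos.le,
      Real.norm_of_nonneg hvpos.le, mul_comm δ] at hle
    exact le_of_mul_le_mul_left hle hvpos
  rw [volume_restrict_unitCube]
  set π := Measure.pi fun _ : Fin (m + 1) => ν
  calc c * π B ≤ c * π {x | c < directionalMax ν i₀ (iteratedMax ν l h) x} +
        d * π {x | d ≤ h x} := by
        refine (mul_le_mul_right ((measure_mono hsub).trans (measure_union_le _ _)) c).trans ?_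
        rw [mul_add]
        exact add_le_add_right (mul_le_mul_left hcd _) _
    _ ≤ 5 * η + η := by
        refine add_le_add ((mul_measure_lt_directionalMax_le hν
          (measurable_iteratedMax l hh) i₀ c).trans (mul_le_mul_right hgmax _)) ?_
        exact (mul_meas_ge_le_lintegral hh d).trans hgint
    _ = 6 * η := by ring

/-- At a point where the averages over small boxes converge to `f x`, both derivatives of the
integral of `f` equal `f x`. There is at least one contracting sequence of boxes, so neither
derivative is a supremum or infimum over the empty set. -/
lemma derivatives_eq_of_forall_abs_mean_sub_le {n : ℕ} {f : (Fin n → ℝ) → ℝ} {x : Fin n → ℝ}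
    (hx : x ∈ unitCube n)
    (h : ∀ δ > 0, ∃ r > 0, ∀ R ∈ rectBasis (unitCube n) x, Metric.diam R < r →
      |mean f R - f x| ≤ δ) :
    upperDerivative (rectBasis (unitCube n)) f x = ((f x : ℝ) : EReal) ∧
      lowerDerivative (rectBasis (unitCube n)) f x = ((f x : ℝ) : EReal) := by
  have hlim : ∀ R, Contracts (rectBasis (unitCube n)) x R →
      Tendsto (fun k => ((mean f (R k) : ℝ) : EReal)) atTop (𝓝 ((f x : ℝ) : EReal)) := by
    intro R hR
    refine (continuous_coe_real_ereal.tendsto _).comp (Metric.tendsto_nhds.2 fun δ hδ => ?_)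
    obtain ⟨r, hr, hrR⟩ := h (δ / 2) (by positivity)
    filter_upwards [hR.2.eventually_lt_const hr] with k hk
    rw [Real.dist_eq]
    exact (hrR _ (hR.1 k) hk).trans_lt (by linarith)
  have hex : ∃ R, Contracts (rectBasis (unitCube n)) x R := by
    obtain ⟨e, he, hball⟩ := Metric.isOpen_iff.1
      (isOpen_set_pi finite_univ fun (_ : Fin n) _ => isOpen_Ioo (a := (0 : ℝ)) (b := 1)) x hx
    have hpos : ∀ k : ℕ, 0 < e / ((k : ℝ) + 1) := fun k => by positivity
    refine ⟨fun k => Metric.ball x (e / ((k : ℝ) + 1)), fun k => ⟨?_, ?_, ?_⟩, ?_⟩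
    · refine ⟨fun i => x i - e / ((k : ℝ) + 1), fun i => x i + e / ((k : ℝ) + 1), ?_⟩
      simp only [ball_pi x (hpos k), Real.ball_eq_Ioo]
    · exact Metric.mem_ball_self (hpos k)
    · exact (Metric.ball_subset_ball (div_le_self he.le (by
        linarith [k.cast_nonneg (α := ℝ)]))).trans hball
    · refine squeeze_zero (fun _ => Metric.diam_nonneg)
        (fun k => Metric.diam_ball (hpos k).le) ?_
      have := (tendsto_one_div_add_atTop_nhds_zero_nat (𝕜 := ℝ)).const_mul (2 * e)
      simp only [mul_zero] at this
      refine this.congr fun k => by ring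
  obtain ⟨R₀, hR₀⟩ := hex
  constructor
  · refine le_antisymm (iSup₂_le fun R hR => (hlim R hR).limsup_eq.le) ?_
    exact (hlim R₀ hR₀).limsup_eq.ge.trans
      (le_iSup₂ (f := fun R (_ : Contracts (rectBasis (unitCube n)) x R) =>
        limsup (fun k => ((mean f (R k) : ℝ) : EReal)) atTop) R₀ hR₀)
  · refine le_antisymm ?_ (le_iInf₂ fun R hR => (hlim R hR).liminf_eq.ge)
    exact (iInf₂_le (f := fun R (_ : Contracts (rectBasis (unitCube n)) x R) =>
        liminf (fun k => ((mean f (R k) : ℝ) : EReal)) atTop) R₀ hR₀).trans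
      (hlim R₀ hR₀).liminf_eq.le

/-- The Jessen–Marcinkiewicz–Zygmund theorem for almost everywhere measurable functions. -/
theorem differentiates_rectBasis_of_lintegral_dyadicYoung_ne_top {n : ℕ} (hn : 0 < n)
    {f : (Fin n → ℝ) → ℝ} (hf : IntegrableOn f (unitCube n))
    (hY : ∀ c : ℝ≥0∞, c ≠ ∞ → ∫⁻ x in unitCube n, dyadicYoung (n - 1) (c * ‖f x‖ₑ) ≠ ∞) :
    Differentiates (unitCube n) (rectBasis (unitCube n)) f := by
  have hfm := hf.aestronglyMeasurable.aemeasurable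
  set g := hfm.mk f
  have hfg : f =ᵐ[volume.restrict (unitCube n)] g := hfm.ae_eq_mk
  have hcube : MeasurableSet (unitCube n) := MeasurableSet.univ_pi fun _ => measurableSet_Ioo
  have key := ae_abs_mean_sub_le hn hfm.measurable_mk (hf.congr_fun_ae hfg) fun c hc => by
    rw [← lintegral_congr_ae (hfg.mono fun x hx => by
      show dyadicYoung (n - 1) (c * ‖f x‖ₑ) = _; rw [hx])]
    exact hY c hc
  have hmean : ∀ x, ∀ R ∈ rectBasis (unitCube n) x, mean f R = mean g R := by
    intro x R hR
    rw [mean, mean, integral_congr_ae (ae_restrict_of_ae_restrict_of_subset hR.2.2 hfg)]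
  filter_upwards [key, hfg, ae_restrict_mem hcube] with x hx hfx hxc
  refine derivatives_eq_of_forall_abs_mean_sub_le hxc fun δ hδ => ?_
  obtain ⟨r, hr, hrR⟩ := hx δ hδ
  refine ⟨r, hr, fun R hR hd => ?_⟩
  rw [hmean x R hR, hfx]
  exact hrR R hR hd

/-! ### From the variable exponent modular to `L (log L) ^ m` -/

/-- Multiples of a function in `L (log L) ^ m` have finite dyadic modular. -/
lemma exists_dyadicYoung_ofReal_le (m : ℕ) {c : ℝ≥0∞} (hc : c ≠ ∞) :
    ∃ A : ℝ≥0∞, A ≠ ∞ ∧ ∀ y : ℝ, 0 ≤ y →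
      dyadicYoung m (c * ENNReal.ofReal y) ≤
        A * ENNReal.ofReal (y * (1 + Real.posLog y) ^ m) := by
  set b : ℝ := max 1 c.toReal
  have hb : 1 ≤ b := le_max_left _ _
  have hlb : 0 ≤ Real.log b := Real.log_nonneg hb
  have hcb : c ≤ ENNReal.ofReal b :=
    (ENNReal.ofReal_toReal hc).symm.le.trans (ENNReal.ofReal_le_ofReal (le_max_right _ _))
  refine ⟨ENNReal.ofReal (2 * b * (2 + 2 * Real.log b) ^ m), ENNReal.ofReal_ne_top,
    fun y hy => ?_⟩
  refine (monotone_dyadicYoung m (mul_le_mul_left hcb _)).trans ?_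
  rw [← ENNReal.ofReal_mul (by positivity), ← ENNReal.ofReal_mul (by positivity)]
  rcases le_or_gt (ENNReal.ofReal (b * y)) 1 with h | h
  · rw [dyadicYoung_of_le_one m h]
    exact zero_le
  obtain ⟨J, hJ1, hJ2⟩ := exists_two_pow_lt_le h ENNReal.ofReal_ne_top
  have hby : 1 < b * y := ENNReal.one_lt_ofReal.1 h
  have hypos : 0 < y := by
    rcases hy.eq_or_lt with rfl | h'
    · norm_num at hby
    · exact h'
  have hJreal : (2 : ℝ) ^ J < b * y := by
    rw [← ENNReal.ofReal_ofNat, ← ENNReal.ofReal_pow (by norm_num)] at hJ1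
    exact (ENNReal.ofReal_lt_ofReal_iff (by positivity)).1 hJ1
  have hplog : 0 ≤ Real.posLog y := Real.posLog_nonneg
  have hJlog : (J : ℝ) + 1 ≤ (2 + 2 * Real.log b) * (1 + Real.posLog y) := by
    have h1 := Real.log_lt_log (by positivity) hJreal
    rw [Real.log_pow, Real.log_mul (by positivity) hypos.ne'] at h1
    have h2 : Real.log y ≤ Real.posLog y := le_max_right _ _
    have h3 := Real.log_two_gt_d9
    have h4 : (J : ℝ) * (1 / 2) ≤ J * Real.log 2 := by gcongr; linarith
    nlinarith [mul_nonneg hlb hplog]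
  have hlevels : dyadicYoung m (ENNReal.ofReal (b * y)) ≤
      2 ^ (J + 1) * ((J : ℝ≥0∞) + 1) ^ m := by
    rw [dyadicYoung, tsum_eq_sum (s := Finset.range (J + 1))]
    · have hgeom : ∀ N : ℕ, ∑ j ∈ Finset.range N, (2 : ℝ≥0∞) ^ j ≤ 2 ^ N := by
        intro N
        induction N with
        | zero => simp
        | succ N ih =>
          rw [Finset.sum_range_succ, pow_succ, mul_two]
          exact add_le_add_left ih _
      calc _ ≤ ∑ j ∈ Finset.range (J + 1), (2 : ℝ≥0∞) ^ j * ((J : ℝ≥0∞) + 1) ^ m := by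
            refine Finset.sum_le_sum fun j hj => (indicator_le_self _ _ _).trans ?_
            have : j ≤ J := by simpa [Nat.lt_succ_iff] using hj
            gcongr
        _ ≤ _ := by
            rw [← Finset.sum_mul]
            exact mul_le_mul_left (hgeom _) _
    · intro j hj
      have hj' : J + 1 ≤ j := by simpa using hj
      have : ¬ (2 : ℝ≥0∞) ^ j < ENNReal.ofReal (b * y) :=
        not_lt.2 (hJ2.trans (pow_le_pow_right₀ (by norm_num) hj'))
      simp [this]
  have hcast : (2 : ℝ≥0∞) ^ (J + 1) * ((J : ℝ≥0∞) + 1) ^ m =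
      ENNReal.ofReal (2 ^ (J + 1) * ((J : ℝ) + 1) ^ m) := by
    rw [ENNReal.ofReal_mul (by positivity), ENNReal.ofReal_pow (by norm_num),
      ENNReal.ofReal_pow (by positivity), ENNReal.ofReal_add (by positivity) (by norm_num)]
    simp
  refine hlevels.trans ?_
  rw [hcast]
  refine ENNReal.ofReal_le_ofReal ?_
  calc (2 : ℝ) ^ (J + 1) * ((J : ℝ) + 1) ^ m
      ≤ (2 * (b * y)) * ((2 + 2 * Real.log b) * (1 + Real.posLog y)) ^ m := by
        rw [pow_succ, mul_comm ((2 : ℝ) ^ J)]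
        gcongr
    _ = _ := by rw [mul_pow]; ring

/-- Above the threshold `s ^ (m * q)`, the `m`-th power of the logarithm is dominated by the power
`1 / q`, with an explicit constant. -/
lemma one_add_log_pow_le {m q : ℕ} (hm : m ≠ 0) (hq : q ≠ 0) {s y : ℝ} (hs : 1 ≤ s)
    (hy : s ^ (m * q) ≤ y) :
    (1 + Real.log y) ^ m ≤
      ((1 + m * q * Real.log s + m * q) / s) ^ m * y ^ (1 / (q : ℝ)) := by
  have hs0 : 0 < s := by linarith
  have hy1 : 1 ≤ y := (one_le_pow₀ hs).trans hy
  have hy0 : 0 ≤ y := by linarith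
  have hmq : m * q ≠ 0 := mul_ne_zero hm hq
  set z : ℝ := y ^ (((m * q : ℕ) : ℝ)⁻¹)
  have hz0 : 0 ≤ z := Real.rpow_nonneg hy0 _
  have hzy : z ^ (m * q) = y := Real.rpow_inv_natCast_pow hy0 hmq
  have hsz : s ≤ z := by
    rw [← hzy] at hy
    exact le_of_pow_le_pow_left₀ hmq hz0 hy
  have hzm : z ^ m = y ^ (1 / (q : ℝ)) := by
    rw [← Real.rpow_natCast z m, ← Real.rpow_mul hy0]
    congr 1
    have : (m : ℝ) ≠ 0 := by exact_mod_cast hm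
    have : (q : ℝ) ≠ 0 := by exact_mod_cast hq
    push_cast
    field_simp
  have hls : 0 ≤ Real.log s := Real.log_nonneg hs
  have hlog : Real.log y = m * q * (Real.log s + Real.log (z / s)) := by
    rw [← Real.log_mul hs0.ne' (by have : 0 < z := by linarith
                                   positivity), mul_div_cancel₀ _ hs0.ne', ← hzy, Real.log_pow]
    push_cast
    rfl
  have hw : 1 ≤ z / s := (one_le_div hs0).2 hsz
  have hlw : Real.log (z / s) ≤ z / s :=
    (Real.log_le_sub_one_of_pos (by linarith)).trans (by linarith)
  have hbase : 1 + Real.log y ≤ ((1 + m * q * Real.log s + m * q) / s) * z := by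
    have h1 : ((1 + m * q * Real.log s + m * q) / s) * z =
        (1 + m * q * Real.log s) * (z / s) + m * q * (z / s) := by
      field_simp
    rw [h1, hlog, mul_add, ← add_assoc]
    have h2 : (m * q : ℝ) * Real.log (z / s) ≤ m * q * (z / s) := by gcongr
    have h3 : 1 + m * q * Real.log s ≤ (1 + m * q * Real.log s) * (z / s) :=
      le_mul_of_one_le_right (by positivity) hw
    linarith
  calc (1 + Real.log y) ^ m ≤ (((1 + m * q * Real.log s + m * q) / s) * z) ^ m :=
        pow_le_pow_left₀ (by linarith [Real.log_nonneg hy1]) hbase m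
    _ = _ := by rw [mul_pow, hzm]

/-- The threshold separating small from large values on the set `1 + 1 / (k + 1) < p ≤ 1 + 1 / k`,
for `C` the constant of the decay condition. Up to geometric and polynomial factors it is the
reciprocal of the bound for the measure of this set. -/
def layerThreshold (C : ℝ) (m k : ℕ) : ℝ :=
  (k * Real.log k / (2 * C)) ^ (m * (k + 1))

/-- The value of `t (1 + log t) ^ m` at the threshold. -/
def layerBound (C : ℝ) (m k : ℕ) : ℝ :=
  layerThreshold C m k * (1 + Real.log (layerThreshold C m k)) ^ m

section Layers

variable {C : ℝ} {m k : ℕ}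

lemma one_le_log_natCast (hk : 3 ≤ k) : 1 ≤ Real.log k := by
  rw [Real.le_log_iff_exp_le (by positivity)]
  have : (3 : ℝ) ≤ k := by exact_mod_cast hk
  linarith [Real.exp_one_lt_d9]

lemma one_le_mul_log_div (hC : 1 < C) (hk : 3 ≤ k) (hkC : 2 * C ≤ k) :
    1 ≤ k * Real.log k / (2 * C) := by
  rw [one_le_div (by linarith)]
  exact hkC.trans (le_mul_of_one_le_right (by positivity) (one_le_log_natCast hk))

lemma one_le_layerThreshold (hC : 1 < C) (hk : 3 ≤ k) (hkC : 2 * C ≤ k) :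
    1 ≤ layerThreshold C m k := one_le_pow₀ (one_le_mul_log_div hC hk hkC)

lemma one_le_layerBound (hC : 1 < C) (hk : 3 ≤ k) (hkC : 2 * C ≤ k) : 1 ≤ layerBound C m k := by
  have h := one_le_layerThreshold (m := m) hC hk hkC
  refine one_le_mul_of_one_le_of_one_le h (one_le_pow₀ ?_)
  linarith [Real.log_nonneg h]

lemma log_mul_log_div_le (hC : 1 < C) (hk : 3 ≤ k) (hkC : 2 * C ≤ k) :
    Real.log (k * Real.log k / (2 * C)) ≤ 2 * Real.log k := by
  have hk0 : (0 : ℝ) < k := by positivity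
  have h1 := one_le_mul_log_div hC hk hkC
  have h2 : k * Real.log k / (2 * C) ≤ (k : ℝ) ^ 2 := by
    have h3 : Real.log k ≤ k := (Real.log_le_sub_one_of_pos hk0).trans (by linarith)
    have h4 := one_le_log_natCast hk
    rw [sq]
    exact (div_le_self (by positivity) (by linarith)).trans (by gcongr)
  refine (Real.log_le_log (by linarith) h2).trans_eq ?_
  rw [Real.log_pow]
  norm_num

/-- Beyond the threshold of the layer, `t (log t) ^ m` is dominated by `t ^ p`, with a constant
independent of the layer. -/
lemma mul_one_add_log_pow_le_rpow (hC : 1 < C) (hm : m ≠ 0) (hk : 3 ≤ k) (hkC : 2 * C ≤ k)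
    {y P : ℝ} (hy : layerThreshold C m k ≤ y) (hP : 1 + 1 / ((k : ℝ) + 1) ≤ P) :
    y * (1 + Real.log y) ^ m ≤ (14 * C * m) ^ m * y ^ P := by
  set s := k * Real.log k / (2 * C) with hsdef
  have hs : 1 ≤ s := one_le_mul_log_div hC hk hkC
  have hy1 : 1 ≤ y := (one_le_layerThreshold hC hk hkC).trans hy
  have hlk := one_le_log_natCast hk
  have hm1 : (1 : ℝ) ≤ m := by exact_mod_cast Nat.one_le_iff_ne_zero.2 hm
  have hk1 : (1 : ℝ) ≤ k := by exact_mod_cast (by omega : 1 ≤ k)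
  have h1 := one_add_log_pow_le hm (Nat.succ_ne_zero k) hs hy
  have h2 : (1 + m * ((k + 1 : ℕ) : ℝ) * Real.log s + m * ((k + 1 : ℕ) : ℝ)) / s ≤ 14 * C * m := by
    -- With `k + 1 ≤ 2 k` and `1 ≤ log k`, the numerator is at most `(1 + 4 m + 2 m) k log k`.
    rw [div_le_iff₀ (by linarith)]
    have h3 : 14 * C * m * s = 7 * m * (k * Real.log k) := by
      rw [hsdef]; field_simp; ring
    have h4 : Real.log s ≤ 2 * Real.log k := log_mul_log_div_le hC hk hkC
    have h5 : (m : ℝ) * ((k + 1 : ℕ) : ℝ) ≤ 2 * (m * k) := by push_cast; nlinarith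
    have hls : 0 ≤ Real.log s := Real.log_nonneg hs
    have h6 : (m : ℝ) * ((k + 1 : ℕ) : ℝ) * Real.log s ≤ 2 * (m * k) * (2 * Real.log k) := by
      gcongr
    have h7 : (m : ℝ) * k ≤ m * k * Real.log k := le_mul_of_one_le_right (by positivity) hlk
    have h8 : (1 : ℝ) ≤ m * k := one_le_mul_of_one_le_of_one_le hm1 hk1
    rw [h3]
    nlinarith
  have h0 : 0 ≤ (1 + m * ((k + 1 : ℕ) : ℝ) * Real.log s + m * ((k + 1 : ℕ) : ℝ)) / s := by
    have := Real.log_nonneg hs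
    positivity
  have hy0 : 0 < y := by linarith
  calc y * (1 + Real.log y) ^ m
      ≤ y * ((14 * C * m) ^ m * y ^ (1 / ((k + 1 : ℕ) : ℝ))) := by
        gcongr
        exact h1.trans (by gcongr)
    _ = (14 * C * m) ^ m * y ^ (1 + 1 / ((k : ℝ) + 1)) := by
        rw [Real.rpow_add hy0, Real.rpow_one]
        push_cast
        ring
    _ ≤ _ := by gcongr

/-- The decay of the measures of the layers makes up for the thresholds. -/
lemma layer_measure_mul_layerBound_le (hC : 1 < C) (hm : m ≠ 0) (hk : 3 ≤ k) (hkC : 2 * C ≤ k) :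
    C ^ k * ((k * Real.log k) ^ (m * k))⁻¹ * layerBound C m k ≤
      (3 * m) ^ m * ((k : ℝ) ^ (5 * m) * (1 / 2) ^ k) := by
  set L := k * Real.log k with hL
  have hlk := one_le_log_natCast hk
  have hk0 : (0 : ℝ) < k := by positivity
  have hk1 : (1 : ℝ) ≤ k := by exact_mod_cast (by omega : 1 ≤ k)
  have hm1 : (1 : ℝ) ≤ m := by exact_mod_cast Nat.one_le_iff_ne_zero.2 hm
  have hlkk : Real.log k ≤ k := (Real.log_le_sub_one_of_pos hk0).trans (by linarith)
  have hL0 : 0 < L := by positivity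
  have hLk : L ≤ (k : ℝ) ^ 2 := by rw [hL, sq]; gcongr
  have hs := one_le_mul_log_div hC hk hkC
  have hT : Real.log (layerThreshold C m k) ≤ m * (k + 1) * (2 * Real.log k) := by
    rw [layerThreshold, Real.log_pow]
    push_cast
    gcongr
    exact log_mul_log_div_le hC hk hkC
  have hT0 : 0 ≤ Real.log (layerThreshold C m k) :=
    Real.log_nonneg (one_le_layerThreshold hC hk hkC)
  have hlog2 : 2 * Real.log k ≤ (k : ℝ) ^ 2 := by
    have h3 : (3 : ℝ) ≤ k := by exact_mod_cast hk
    nlinarith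
  have hfac : 1 + Real.log (layerThreshold C m k) ≤ 3 * m * (k : ℝ) ^ 3 := by
    have h1 : (m : ℝ) * (k + 1) * (2 * Real.log k) ≤ m * (2 * k) * (k : ℝ) ^ 2 := by
      gcongr
      linarith
    have h2 : (1 : ℝ) ≤ m * (k : ℝ) ^ 3 := one_le_mul_of_one_le_of_one_le hm1 (one_le_pow₀ hk1)
    nlinarith
  have h2C : (1 : ℝ) ≤ 2 * C := by linarith
  have hpow : C ^ k * (L ^ (m * k))⁻¹ * layerThreshold C m k ≤ L ^ m * (1 / 2) ^ k := by
    rw [layerThreshold, ← hL, div_pow, mul_add, mul_one, pow_add L]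
    have h1 : (2 * C) ^ k ≤ (2 * C) ^ (m * k + m) :=
      pow_le_pow_right₀ h2C (by nlinarith [Nat.one_le_iff_ne_zero.2 hm])
    calc C ^ k * (L ^ (m * k))⁻¹ * (L ^ (m * k) * L ^ m / (2 * C) ^ (m * k + m))
        = C ^ k * L ^ m / (2 * C) ^ (m * k + m) := by
          have : L ^ (m * k) ≠ 0 := by positivity
          field_simp
      _ ≤ C ^ k * L ^ m / (2 * C) ^ k := by gcongr
      _ = L ^ m * (1 / 2) ^ k := by
          rw [mul_pow, one_div, inv_pow]
          have : C ^ k ≠ 0 := by positivity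
          field_simp
          rw [mul_pow, mul_comm]
  calc C ^ k * (L ^ (m * k))⁻¹ * layerBound C m k
      = C ^ k * (L ^ (m * k))⁻¹ * layerThreshold C m k *
          (1 + Real.log (layerThreshold C m k)) ^ m := by rw [layerBound]; ring
    _ ≤ ((k : ℝ) ^ 2) ^ m * (1 / 2) ^ k * (3 * m * (k : ℝ) ^ 3) ^ m := by
        have : 0 ≤ layerThreshold C m k := by linarith [one_le_layerThreshold (m := m) hC hk hkC]
        refine mul_le_mul (hpow.trans (by gcongr)) ?_ (by positivity) (by positivity)
        gcongr
    _ = _ := by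
        rw [mul_pow, show 5 * m = 2 * m + 3 * m by ring, pow_add, pow_mul, pow_mul]
        ring

/-- The pointwise form of the embedding. At `P = 1` the sum on the right diverges. -/
lemma ofReal_mul_one_add_posLog_pow_le (hC : 1 < C) (hm : m ≠ 0) {k₀ : ℕ} (hk₀ : 3 ≤ k₀)
    (hkC : 2 * C ≤ k₀) {y : ℝ} (hy : 0 ≤ y) {P : ℝ≥0∞} (hP1 : 1 ≤ P) (hP : P ≠ ∞) :
    ENNReal.ofReal (y * (1 + Real.posLog y) ^ m) ≤
      (1 + ∑' j : ℕ, (Iic (1 + ENNReal.ofReal (1 / ((j + k₀ : ℕ) : ℝ)))).indicator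
        (fun _ => ENNReal.ofReal (layerBound C m (j + k₀))) P) +
      ENNReal.ofReal ((14 * C * m) ^ m + (1 + m * k₀) ^ m) * ENNReal.ofReal y ^ P.toReal := by
  have hkC' : ∀ j : ℕ, 2 * C ≤ ((j + k₀ : ℕ) : ℝ) := fun j => by
    push_cast; linarith [j.cast_nonneg (α := ℝ)]
  have hk' : ∀ j : ℕ, 3 ≤ j + k₀ := fun j => by omega
  rcases le_or_gt y 1 with hy1 | hy1
  · refine le_trans ?_ (le_self_add.trans le_self_add)
    rw [(Real.posLog_eq_zero_iff y).2 (by rwa [abs_of_nonneg hy])]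
    simpa using hy1
  have hlog : Real.posLog y = Real.log y :=
    Real.posLog_eq_log (by rw [abs_of_nonneg hy]; exact hy1.le)
  rw [hlog]
  have hreal : ∀ K : ℝ, 0 ≤ K → K ≤ (14 * C * m) ^ m + (1 + m * k₀) ^ m →
      y * (1 + Real.log y) ^ m ≤ K * y ^ P.toReal →
      ENNReal.ofReal (y * (1 + Real.log y) ^ m) ≤
        ENNReal.ofReal ((14 * C * m) ^ m + (1 + m * k₀) ^ m) * ENNReal.ofReal y ^ P.toReal := by
    intro K hK0 hK h
    rw [ENNReal.ofReal_rpow_of_pos (by linarith), ← ENNReal.ofReal_mul (hK0.trans hK)]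
    exact ENNReal.ofReal_le_ofReal (h.trans (by gcongr))
  have hPr : ∀ t : ℝ, 0 ≤ t → (P ≤ 1 + ENNReal.ofReal t ↔ P.toReal ≤ 1 + t) := by
    intro t ht
    rw [← ENNReal.ofReal_one, ← ENNReal.ofReal_add zero_le_one ht,
      ENNReal.le_ofReal_iff_toReal_le hP (by positivity)]
  have hP1r : 1 ≤ P.toReal := by
    have := ENNReal.toReal_mono hP hP1
    simpa using this
  have hk0pos : (0 : ℝ) < k₀ := by positivity
  -- At `P = 1` every term of the sum is at least `1`; away from `1` a fixed power suffices;
  -- near `1` the layer containing `P` has index `⌊1 / (P - 1)⌋`.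
  rcases hP1r.eq_or_lt with hPeq | hPlt
  · refine le_trans le_top (le_trans (le_of_eq ?_) le_self_add)
    symm
    rw [ENNReal.add_eq_top]
    refine .inr (top_unique ?_)
    rw [← ENNReal.tsum_const_eq_top_of_ne_zero (α := ℕ) (one_ne_zero)]
    refine ENNReal.tsum_le_tsum fun j => ?_
    have hmem : P ∈ Iic (1 + ENNReal.ofReal (1 / ((j + k₀ : ℕ) : ℝ))) := by
      rw [mem_Iic, hPr _ (by positivity), ← hPeq]
      have : (0 : ℝ) ≤ 1 / ((j + k₀ : ℕ) : ℝ) := by positivity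
      linarith
    rw [indicator_of_mem hmem, ENNReal.one_le_ofReal]
    exact one_le_layerBound hC (hk' j) (hkC' j)
  rcases lt_or_ge (1 + 1 / (k₀ : ℝ)) P.toReal with hfar | hnear
  · refine (hreal ((1 + m * k₀) ^ m) (by positivity) ?_ ?_).trans le_add_self
    · have : 0 ≤ (14 * C * m) ^ m := by positivity
      linarith
    · have h1 := one_add_log_pow_le (s := 1) hm (by omega : k₀ ≠ 0) le_rfl (by simpa using hy1.le)
      simp only [Real.log_one, mul_zero, add_zero, div_one] at h1
      calc y * (1 + Real.log y) ^ m ≤ y * ((1 + m * k₀) ^ m * y ^ (1 / (k₀ : ℝ))) := by gcongr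
        _ = (1 + m * k₀) ^ m * y ^ (1 + 1 / (k₀ : ℝ)) := by
          rw [Real.rpow_add (by linarith), Real.rpow_one]; ring
        _ ≤ _ := by gcongr; exact hy1.le
  · set ε := P.toReal - 1
    have hε : 0 < ε := by simp only [ε]; linarith
    have hfl : k₀ ≤ ⌊1 / ε⌋₊ := by
      refine Nat.le_floor ?_
      rw [le_one_div hk0pos hε]
      simp only [ε]; linarith
    obtain ⟨j, hj⟩ : ∃ j, ⌊1 / ε⌋₊ = j + k₀ := ⟨⌊1 / ε⌋₊ - k₀, by omega⟩
    have hkpos : (0 : ℝ) < ((j + k₀ : ℕ) : ℝ) := by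
      have : 0 < j + k₀ := by omega
      exact_mod_cast this
    have hupper : P.toReal ≤ 1 + 1 / ((j + k₀ : ℕ) : ℝ) := by
      have h1 : ((j + k₀ : ℕ) : ℝ) ≤ 1 / ε := by
        rw [← hj]; exact Nat.floor_le (by positivity)
      have h2 := (le_one_div hkpos hε).1 h1
      simp only [ε] at h2
      linarith
    have hlower : 1 + 1 / (((j + k₀ : ℕ) : ℝ) + 1) ≤ P.toReal := by
      have h1 : 1 / ε < ((j + k₀ : ℕ) : ℝ) + 1 := by
        rw [← hj]; exact Nat.lt_floor_add_one _
      have h2 := (one_div_lt hε (by positivity)).1 h1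
      simp only [ε] at h2
      linarith
    rcases le_or_gt (layerThreshold C m (j + k₀)) y with hbig | hsmall
    · refine (hreal ((14 * C * m) ^ m) (by positivity) ?_
        (mul_one_add_log_pow_le_rpow hC hm (hk' j) (hkC' j) hbig hlower)).trans le_add_self
      have : 0 ≤ (1 + (m : ℝ) * k₀) ^ m := by positivity
      linarith
    · refine le_trans ?_ ((ENNReal.le_tsum j).trans (le_add_self.trans le_self_add))
      rw [indicator_of_mem (by rw [mem_Iic, hPr _ (by positivity)]; exact hupper)]
      refine ENNReal.ofReal_le_ofReal ?_
      have hly := Real.log_nonneg hy1.le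
      rw [layerBound]
      have hll := Real.log_le_log (by linarith) hsmall.le
      have hT0 : 0 ≤ layerThreshold C m (j + k₀) := by linarith
      gcongr

end Layers

/-- If the exponent is close to `1` only on small sets, as measured by the decay condition, then a
function with finite modular belongs to `L (log L) ^ m`. -/
lemma lintegral_mul_one_add_posLog_pow_ne_top {α : Type*} [MeasurableSpace α] {μ : Measure α}
    [IsFiniteMeasure μ] {m : ℕ} (hm : m ≠ 0) {p : α → ℝ≥0∞} (hp : AEMeasurable p μ)
    (hp1 : ∀ᵐ x ∂μ, 1 ≤ p x ∧ p x ≠ ∞) {C : ℝ} (hC : 1 < C)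
    (hdist : ∀ᶠ t : ℝ in 𝓝[>] (0 : ℝ), μ {x | p x ≤ 1 + ENNReal.ofReal t} ≤
        ENNReal.ofReal (C ^ (1 / t) * t ^ ((m : ℝ) / t) * Real.log (1 / t) ^ (-((m : ℝ) / t))))
    {u : α → ℝ} (hu0 : ∀ x, 0 ≤ u x)
    (hu : ∫⁻ x, ENNReal.ofReal (u x) ^ (p x).toReal ∂μ ≠ ∞) :
    ∫⁻ x, ENNReal.ofReal (u x * (1 + Real.posLog (u x)) ^ m) ∂μ ≠ ∞ := by
  have hseq : Tendsto (fun k : ℕ => 1 / (k : ℝ)) atTop (𝓝[>] 0) := by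
    refine tendsto_nhdsWithin_iff.2 ⟨tendsto_one_div_atTop_nhds_zero_nat, ?_⟩
    filter_upwards [eventually_gt_atTop 0] with k hk
    have : (0 : ℝ) < k := by exact_mod_cast hk
    exact one_div_pos.2 this
  obtain ⟨k₁, hk₁⟩ := eventually_atTop.1 (hseq.eventually hdist)
  obtain ⟨k₂, hk₂⟩ := exists_nat_ge (2 * C)
  set k₀ := max 3 (max k₁ k₂)
  have hk3 : 3 ≤ k₀ := le_max_left _ _
  have hkC : ∀ k ≥ k₀, 2 * C ≤ (k : ℝ) := by
    intro k hk
    refine hk₂.trans ?_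
    exact_mod_cast (le_max_right k₁ k₂).trans ((le_max_right _ _).trans hk)
  have hmeas : ∀ k ≥ k₀, μ {x | p x ≤ 1 + ENNReal.ofReal (1 / (k : ℝ))} ≤
      ENNReal.ofReal (C ^ k * ((k * Real.log k) ^ (m * k))⁻¹) := by
    intro k hk
    refine (hk₁ k ((le_max_left k₁ k₂).trans ((le_max_right _ _).trans hk))).trans_eq ?_
    have hk0 : (0 : ℝ) < k := by
      have : 0 < k := by omega
      exact_mod_cast this
    congr 1
    have hl := one_le_log_natCast (hk3.trans hk)
    rw [one_div_one_div, Real.rpow_natCast, div_div_eq_mul_div, div_one, ← Nat.cast_mul,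
      Real.rpow_neg (by linarith), Real.rpow_natCast, Real.rpow_natCast, mul_pow, one_div, inv_pow,
      mul_inv, mul_assoc]
  set W : α → ℝ≥0∞ := fun x => 1 + ∑' j : ℕ,
    (Iic (1 + ENNReal.ofReal (1 / ((j + k₀ : ℕ) : ℝ)))).indicator
      (fun _ => ENNReal.ofReal (layerBound C m (j + k₀))) (p x)
  have hterm : ∀ j : ℕ, Measurable ((Iic (1 + ENNReal.ofReal (1 / ((j + k₀ : ℕ) : ℝ)))).indicator
      (fun _ => ENNReal.ofReal (layerBound C m (j + k₀)))) := fun j =>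
    measurable_const.indicator measurableSet_Iic
  have hWm : AEMeasurable W μ :=
    (measurable_const.add (Measurable.tsum hterm)).comp_aemeasurable hp
  have hsum : ∫⁻ x, W x ∂μ ≠ ∞ := by
    have hle : ∀ j : ℕ, ∫⁻ x, (Iic (1 + ENNReal.ofReal (1 / ((j + k₀ : ℕ) : ℝ)))).indicator
        (fun _ => ENNReal.ofReal (layerBound C m (j + k₀))) (p x) ∂μ ≤
        ENNReal.ofReal ((3 * m) ^ m * ((((j + k₀ : ℕ) : ℝ)) ^ (5 * m) * (1 / 2) ^ (j + k₀))) := by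
      intro j
      have hj : k₀ ≤ j + k₀ := by omega
      have hset : NullMeasurableSet {x | p x ≤ 1 + ENNReal.ofReal (1 / ((j + k₀ : ℕ) : ℝ))} μ :=
        hp.nullMeasurableSet_preimage measurableSet_Iic
      calc _ = ∫⁻ x, {x | p x ≤ 1 + ENNReal.ofReal (1 / ((j + k₀ : ℕ) : ℝ))}.indicator
            (fun _ => ENNReal.ofReal (layerBound C m (j + k₀))) x ∂μ := rfl
        _ = ENNReal.ofReal (layerBound C m (j + k₀)) *
            μ {x | p x ≤ 1 + ENNReal.ofReal (1 / ((j + k₀ : ℕ) : ℝ))} := by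
            rw [lintegral_indicator_const₀ hset]
        _ ≤ ENNReal.ofReal (layerBound C m (j + k₀)) * ENNReal.ofReal
            (C ^ (j + k₀) * ((((j + k₀ : ℕ) : ℝ) * Real.log ((j + k₀ : ℕ) : ℝ)) ^
              (m * (j + k₀)))⁻¹) := mul_le_mul_right (hmeas _ hj) _
        _ ≤ _ := by
            have hB := one_le_layerBound (m := m) hC (hk3.trans hj) (hkC _ hj)
            rw [← ENNReal.ofReal_mul (by linarith), mul_comm]
            exact ENNReal.ofReal_le_ofReal
              (layer_measure_mul_layerBound_le hC hm (hk3.trans hj) (hkC _ hj))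
    have hsummable : Summable fun j : ℕ =>
        ((3 : ℝ) * m) ^ m * ((((j + k₀ : ℕ) : ℝ)) ^ (5 * m) * (1 / 2) ^ (j + k₀)) := by
      refine Summable.mul_left _ ?_
      refine (summable_nat_add_iff (f := fun k : ℕ => (k : ℝ) ^ (5 * m) * (1 / 2) ^ k) k₀).2 ?_
      exact summable_pow_mul_geometric_of_norm_lt_one _ (by norm_num)
    simp only [W]
    rw [lintegral_add_left measurable_const, lintegral_tsum]
    swap
    · exact fun j => (hterm j).comp_aemeasurable hp
    refine ENNReal.add_ne_top.2 ⟨by simp, ?_⟩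
    refine ne_top_of_le_ne_top ?_ (ENNReal.tsum_le_tsum hle)
    exact hsummable.tsum_ofReal_ne_top
  refine ne_top_of_le_ne_top ?_ (lintegral_mono_ae (hp1.mono fun x hx =>
    ofReal_mul_one_add_posLog_pow_le hC hm hk3 (hkC k₀ le_rfl) (hu0 x) hx.1 hx.2))
  rw [lintegral_add_left' hWm, lintegral_const_mul' _ _ ENNReal.ofReal_ne_top]
  exact ENNReal.add_ne_top.2 ⟨hsum, ENNReal.mul_ne_top ENNReal.ofReal_ne_top hu⟩

end StrongDiff

end

open StrongDiff in
theorem theorem3p1 (n : ℕ) (hn : 1 < n) (p : (Fin n → ℝ) → ℝ≥0∞)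
    (hp : StrongDiff.IsExponent (StrongDiff.unitCube n) p)
    (hdist : ∃ C : ℝ, 1 < C ∧ ∀ᶠ t : ℝ in 𝓝[>] (0 : ℝ),
      volume {x ∈ StrongDiff.unitCube n | p x ≤ 1 + ENNReal.ofReal t} ≤
        ENNReal.ofReal (C ^ (1 / t) * t ^ (((n : ℝ) - 1) / t) *
          Real.log (1 / t) ^ (-(((n : ℝ) - 1) / t)))) :
    ∀ f : (Fin n → ℝ) → ℝ, StrongDiff.MemVarLp (StrongDiff.unitCube n) p f →
      IntegrableOn f (StrongDiff.unitCube n) ∧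
      StrongDiff.Differentiates (StrongDiff.unitCube n)
        (StrongDiff.rectBasis (StrongDiff.unitCube n)) f := by
  intro f ⟨hfm, s, hs, hmod⟩
  obtain ⟨C, hC, hdist⟩ := hdist
  have hcube : MeasurableSet (unitCube n) := MeasurableSet.univ_pi fun _ => measurableSet_Ioo
  have hcube1 : volume (unitCube n) = 1 := by
    rw [unitCube, volume_pi_pi]; simp
  have hfin : ∀ S ⊆ unitCube n, volume S ≠ ∞ := fun S hS =>
    ne_top_of_le_ne_top (by rw [hcube1]; simp) (measure_mono hS)
  set A := {x ∈ unitCube n | p x ≠ ∞}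
  set B := {x ∈ unitCube n | p x = ∞}
  have hA : A ⊆ unitCube n := fun x hx => hx.1
  have hB : B ⊆ unitCube n := fun x hx => hx.1
  have hAB : unitCube n ⊆ A ∪ B := fun x hx => by
    by_cases h : p x = ∞
    · exact .inr ⟨hx, h⟩
    · exact .inl ⟨hx, h⟩
  have hm : n - 1 ≠ 0 := by omega
  have hcast : ((n - 1 : ℕ) : ℝ) = (n : ℝ) - 1 := by
    rw [Nat.cast_sub hn.le, Nat.cast_one]
  rw [modular, ENNReal.add_lt_top] at hmod
  obtain ⟨hmodA, hmodB⟩ := hmod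
  have : IsFiniteMeasure (volume.restrict A) := ⟨by
    simpa using (hfin A hA).lt_top⟩
  -- On `{p < ∞}` the function is in `L (log L) ^ (n - 1)`.
  have hLlogL : ∫⁻ x in A, ENNReal.ofReal (|f x| / s * (1 + Real.posLog (|f x| / s)) ^ (n - 1))
      ≠ ∞ := by
    have hpA : AEMeasurable p (volume.restrict A) :=
      hp.1.mono_measure (Measure.restrict_mono hA le_rfl)
    have hset : NullMeasurableSet A := by
      have h1 : NullMeasurableSet {x | p x ≠ ∞} (volume.restrict (unitCube n)) :=
        hp.1.nullMeasurableSet_preimage (measurableSet_singleton ∞).compl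
      have h2 := (nullMeasurableSet_restrict hcube.nullMeasurableSet).1 h1
      rwa [inter_comm] at h2
    refine lintegral_mul_one_add_posLog_pow_ne_top hm hpA ?_ hC ?_
      (fun x => div_nonneg (abs_nonneg _) hs.le) hmodA.ne
    · filter_upwards [ae_restrict_mem₀ hset] with x hx
      exact ⟨hp.2 x hx.1, hx.2⟩
    · filter_upwards [hdist] with t ht
      rw [hcast]
      refine le_trans ?_ ht
      refine (Measure.restrict_mono hA le_rfl _).trans ?_
      rw [Measure.restrict_apply' hcube, inter_comm]
      rfl
  -- On `{p = ∞}` the function is essentially bounded.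
  have hbdd : eLpNormEssSup f (volume.restrict B) ≠ ∞ := by
    intro h
    rw [h, ENNReal.mul_top (by simpa using hs)] at hmodB
    exact lt_irrefl _ hmodB
  have hY : ∀ c : ℝ≥0∞, c ≠ ∞ → ∫⁻ x in unitCube n, dyadicYoung (n - 1) (c * ‖f x‖ₑ) ≠ ∞ := by
    intro c hc
    refine ne_top_of_le_ne_top (ENNReal.add_ne_top.2 ⟨?_, ?_⟩)
      ((lintegral_mono_set hAB).trans (lintegral_union_le _ A B))
    · obtain ⟨K, hK, hKle⟩ := exists_dyadicYoung_ofReal_le (n - 1)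
        (c := c * ENNReal.ofReal s) (ENNReal.mul_ne_top hc ENNReal.ofReal_ne_top)
      refine ne_top_of_le_ne_top ?_ (lintegral_mono fun x => ?_ : _ ≤ ∫⁻ x in A, K *
        ENNReal.ofReal (|f x| / s * (1 + Real.posLog (|f x| / s)) ^ (n - 1)))
      · rw [lintegral_const_mul' _ _ hK]
        exact ENNReal.mul_ne_top hK hLlogL
      · refine le_trans (le_of_eq ?_) (hKle (|f x| / s) (div_nonneg (abs_nonneg _) hs.le))
        rw [mul_assoc, ← ENNReal.ofReal_mul hs.le, mul_div_cancel₀ _ hs.ne',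
          ← Real.norm_eq_abs, ofReal_norm]
    · set E := eLpNormEssSup f (volume.restrict B)
      obtain ⟨K, hK, hKle⟩ := exists_dyadicYoung_le_mul (n - 1) (ENNReal.mul_ne_top hc hbdd)
      refine ne_top_of_le_ne_top ?_ (lintegral_mono_ae (g := fun _ => K * (c * E))
        ((enorm_ae_le_eLpNormEssSup f _).mono fun x hx => ?_))
      · rw [lintegral_const, Measure.restrict_apply_univ]
        exact ENNReal.mul_ne_top (ENNReal.mul_ne_top hK (ENNReal.mul_ne_top hc hbdd)) (hfin B hB)
      · exact (monotone_dyadicYoung _ (mul_le_mul_right hx c)).trans (hKle _ le_rfl)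
  have hint : IntegrableOn f (unitCube n) := by
    refine ⟨hfm.aestronglyMeasurable, ?_⟩
    have hle : ∀ x, ‖f x‖ₑ ≤ 1 + dyadicYoung (n - 1) (1 * ‖f x‖ₑ) := fun x => by
      rw [one_mul]
      refine (le_one_add_dyadicYoung _).trans (add_le_add_right ?_ _)
      refine ENNReal.tsum_le_tsum fun j => indicator_le_indicator ?_
      exact mul_le_mul_right (pow_le_pow_right₀ le_add_self (Nat.zero_le _)) _
    refine lt_of_le_of_lt (lintegral_mono hle) ?_
    rw [lintegral_add_left measurable_const]
    refine ENNReal.add_lt_top.2 ⟨?_, (hY 1 ENNReal.one_ne_top).lt_top⟩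
    simp [hcube1]
  exact ⟨hint, differentiates_rectBasis_of_lintegral_dyadicYoung_ne_top (by omega) hint hY⟩
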